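/- Let $n,m\ge 1$, let $f\in C^1(\mathbb R^{n}\times\mathbb R^{m},\mathbb R^n)$, $g\in C^1(\mathbb R^{n}\times\mathbb R^{m},\mathbb R^m)$, and consider the interconnected system $\dot y=h(y)$, $y=(x,z)$, $h=(f,g)$. Let $\mathcal K_\infty$ denote the set of continuous, strictly increasing, unbounded functions $[0,\infty)\to[0,\infty)$ vanishing at $0$. For a locally Lipschitz function $\varphi$ and a direction $v$ put $D^+_v\varphi(x)=\limsup_{\tau\searrow0}\frac{\varphi(x+\tau v)-\varphi(x)}{\tau}$. Suppose there are locally Lipschitz, positive definite, proper functions $V:\mathbb R^n\to[0,\infty)$, $W:\mathbb R^m\to[0,\infty)$ and gains $\gamma,\delta\in\mathcal K_\infty$ such that, for all $(x,z)\in\mathbb R^n\times\mathbb R^m$, $$D^+_{f(x,z)}V(x)\le -V(x)+\gamma(W(z)),\qquad D^+_{g(x,z)}W(z)\le -W(z)+\delta(V(x)),$$ and such that the limits of $\gamma(\delta(s))/s$ as $s\to0^+$ and as $s\to\infty$ exist and are both $<1$. (i) Then there are constants $0<M_\ell<M_g$, $N_\ell>0$, $N_g\ge0$ and functions $\sigma_\ell,\sigma_g\in\mathcal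 K_\infty$ such that $$\gamma(\delta(s))<s,\quad \delta(s)<\sigma_\ell(s)<\gamma^{-1}(s)\quad\text{for } 0<s\le M_\ell,$$ $$\gamma(\delta(s))<s,\quad \delta(s)<\sigma_g(s)<\gamma^{-1}(s)\quad\text{for } s\ge M_g. \tag{$*$}$$ (ii) Let $M_\ell,M_g,N_\ell>0$, $N_g\ge0$ and $\sigma_\ell,\sigma_g\in\mathcal K_\infty$ be any data satisfying $(*)$. Put $U_\ell(x,z)=\max\{\sigma_\ell(V(x)),W(z)\}$, $U_g(x,z)=\max\{\sigma_g(V(x)),W(z)\}$, and define the gap region $$\mathbf R=\operatorname{cl}\Big(\{U_g\le\max\{\gamma^{-1}(M_g),N_g\}\}\setminus\{U_\ell\le\min\{\delta(M_\ell),N_\ell\}\}\Big).$$ If $$(\operatorname{div}h(x,z))\,(V(x)+W(z))\ \ge\ \gamma(W(z))+\delta(V(x))\qquad\text{for all }(x,z)\in\mathbf R,$$ then the origin is almost globally asymptotically stable for $\dot y=h(y)$: it is Lyapunov stable, and there is a Lebesgue-null set $\aleph\subset\mathbb R^{n+m}$ such that for every $y\notin\aleph$ the solution $Y(t,y)$ starting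 at $y$ exists for all $t\ge0$ and $\lim_{t\to\infty}|Y(t,y)|=0$. -/

import Mathlib

open Filter Topology MeasureTheory
open scoped NNReal

noncomputable section

/-- Class `K∞`: continuous, strictly increasing, unbounded functions on `[0, ∞)` vanishing at `0`. -/
structure IsKInf (γ : ℝ≥0 → ℝ≥0) : Prop where
  continuous : Continuous γ
  strictMono : StrictMono γ
  map_zero : γ 0 = 0
  unbounded : ¬ BddAbove (Set.range γ)

/-- Locally Lipschitz, positive definite and proper functions (values in `[0, ∞)`). -/
structure IsLyapunovCandidate {E : Type*} [NormedAddCommGroup E] (V : E → ℝ≥0) : Prop where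
  locallyLipschitz : LocallyLipschitz V
  map_zero : V 0 = 0
  pos : ∀ x, x ≠ 0 → 0 < V x
  proper : Tendsto V (cocompact E) atTop

/-- The upper right Dini derivative of `φ` at `x` in the direction `v`,
`limsup_{τ ↘ 0} (φ (x + τ v) - φ x) / τ`, as an extended real number. -/
def diniDeriv {E : Type*} [NormedAddCommGroup E] [NormedSpace ℝ E]
    (φ : E → ℝ≥0) (v x : E) : EReal :=
  limsup (fun τ : ℝ => ((((φ (x + τ • v) : ℝ) - (φ x : ℝ)) / τ : ℝ) : EReal)) (𝓝[>] 0)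

/-- The divergence of a vector field on a finite-dimensional space: the trace of its derivative. -/
def divergence {E : Type*} [NormedAddCommGroup E] [NormedSpace ℝ E] (h : E → E) (y : E) : ℝ :=
  LinearMap.trace ℝ E (fderiv ℝ h y : E →ₗ[ℝ] E)

/-- `Y` is a solution on `[0, ∞)` of `ẏ = h(y)` with `Y 0 = y`. -/
def IsForwardSolution {E : Type*} [NormedAddCommGroup E] [NormedSpace ℝ E]
    (h : E → E) (y : E) (Y : ℝ → E) : Prop :=
  Y 0 = y ∧ ∀ t : ℝ, 0 ≤ t → HasDerivWithinAt Y (h (Y t)) (Set.Ici 0) t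

/-- The origin is stable in the sense of Lyapunov for `ẏ = h(y)`
(solutions starting near the origin are defined on `[0, ∞)`). -/
def IsLyapunovStable {E : Type*} [NormedAddCommGroup E] [NormedSpace ℝ E] (h : E → E) : Prop :=
  ∀ ε : ℝ, 0 < ε → ∃ η : ℝ, 0 < η ∧ ∀ y : E, ‖y‖ < η →
    (∃ Y, IsForwardSolution h y Y) ∧
      ∀ Y, IsForwardSolution h y Y → ∀ t : ℝ, 0 ≤ t → ‖Y t‖ < ε

/-- The origin is almost globally asymptotically stable for `ẏ = h(y)`: it is Lyapunov stable, and
outside a Lebesgue-null set of initial conditions solutions exist on `[0, ∞)` and tend to `0`. -/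
def IsAlmostGloballyAsymptoticallyStable {E : Type*} [NormedAddCommGroup E] [NormedSpace ℝ E]
    [MeasureSpace E] (h : E → E) : Prop :=
  IsLyapunovStable h ∧
    ∃ N : Set E, volume N = 0 ∧ ∀ y : E, y ∉ N →
      (∃ Y, IsForwardSolution h y Y) ∧
        ∀ Y, IsForwardSolution h y Y → Tendsto (fun t => ‖Y t‖) atTop (𝓝 0)

/-- The inverse of a gain; a genuine two-sided inverse for functions of class `K∞`. -/
def gainInv (γ : ℝ≥0 → ℝ≥0) : ℝ≥0 → ℝ≥0 := Function.invFun γ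

/-- The small-gain condition `γ ∘ δ < id` on the set `I`, with a class `K∞` function `σ` lying
strictly between `δ` and `γ⁻¹` on `I`. -/
structure SmallGainOn (γ δ σ : ℝ≥0 → ℝ≥0) (I : Set ℝ≥0) : Prop where
  isKInf : IsKInf σ
  smallGain : ∀ s ∈ I, γ (δ s) < s
  lower : ∀ s ∈ I, δ s < σ s
  upper : ∀ s ∈ I, σ s < gainInv γ s

/-- The function `U(x, z) = max {σ(V(x)), W(z)}`. -/
def maxLyapunov {E F : Type*} (σ : ℝ≥0 → ℝ≥0) (V : E → ℝ≥0) (W : F → ℝ≥0) (y : E × F) : ℝ≥0 :=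
  max (σ (V y.1)) (W y.2)

/-- The gap region: the closure of the estimate `{U_g ≤ max {γ⁻¹(M_g), N_g}}` of the global
attractor minus the estimate `{U_ℓ ≤ min {δ(M_ℓ), N_ℓ}}` of the basin of attraction. -/
def gapRegion {E F : Type*} [TopologicalSpace E] [TopologicalSpace F] (V : E → ℝ≥0) (W : F → ℝ≥0)
    (γ δ σl σg : ℝ≥0 → ℝ≥0) (Ml Nl Mg Ng : ℝ≥0) : Set (E × F) :=
  closure ({y | maxLyapunov σg V W y ≤ max (gainInv γ Mg) Ng} \
    {y | maxLyapunov σl V W y ≤ min (δ Ml) Nl})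

end

/-!
The first half of the statement is elementary: wherever `γ ∘ δ < id`, the mean of `δ` and `γ⁻¹` lies
strictly between them (`SmallGainOn.mean_gainInv`).

For the second half, the basic objects are the boxes `{V ≤ p} × {W ≤ q}` with `γ(q) < p` and
`δ(p) < q`. On the boundary of such a box the Dini derivatives of `V` or `W` along the system are
negative, so the box is forward invariant (`IsInterconnection.mem_sublevelBox`). Boxes are compact,
whence the system may be cut off outside a box, and solutions starting there are global and unique.
The functions `σ_ℓ` and `σ_g` provide arbitrarily small boxes, which gives Lyapunov stability, and
boxes containing any given point. The upper limits `a` of `V` and `b` of `W` along a trajectory in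
a box satisfy `a ≤ γ(b)` and `b ≤ δ(a)`, hence `a ≤ γ(δ(a))`
(`IsInterconnection.exists_upper_limits`). The small-gain condition on `[M_g, ∞)` thus forces
`a < M_g`, so every trajectory eventually lies in `{U_g ≤ max {γ⁻¹(M_g), N_g}}`; and the one on
`(0, M_ℓ]` forces `a = b = 0` for trajectories that enter `{U_ℓ ≤ min {δ(M_ℓ), N_ℓ}}`. All other
trajectories finally remain in the gap region.

It remains to see that a compact set `Z` of initial values whose trajectories lie in the gap region
from time `T` on is null. The divergence condition says that there `D⁺(V + W) ≤ (div h - 1)(V + W)`.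
Since `V + W` is bounded above and away from zero on the gap region, integration of its logarithm
shows that `∫₀ᵗ div h` along the trajectories is at least `t` up to a constant
(`IsInterconnection.log_add_le`). By Liouville's formula the volume of the image of `Z` at time `t`
would then grow exponentially if `Z` had positive measure, although the image stays in a box.

Only an inequality of Liouville's type is needed, and it is obtained without differentiating the
flow with respect to the initial value: the iterates of an Euler step `y ↦ y + τ h(y)` are injective
and `C¹`, their Jacobian determinants are products of factors `det (1 + τ Dh) ≈ exp (τ div h)`, and
they are uniformly close to the flow, so the change of variables formula bounds the volume of a
neighbourhood of the image of `Z` from below (`ofReal_exp_mul_measure_le`).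
-/

/-! ### Gains of class `K∞` -/

namespace IsKInf

variable {γ δ : ℝ≥0 → ℝ≥0}

theorem surjective (hγ : IsKInf γ) : Function.Surjective γ := by
  intro s
  obtain ⟨_, ⟨t, rfl⟩, ht⟩ := not_bddAbove_iff.1 hγ.unbounded s
  have := intermediate_value_Icc (zero_le : (0 : ℝ≥0) ≤ t) hγ.continuous.continuousOn
  obtain ⟨r, -, hr⟩ := this ⟨by simp [hγ.map_zero], ht.le⟩
  exact ⟨r, hr⟩

theorem apply_gainInv (hγ : IsKInf γ) (s : ℝ≥0) : γ (gainInv γ s) = s :=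
  Function.invFun_eq (hγ.surjective s)

theorem lt_gainInv_iff (hγ : IsKInf γ) {s t : ℝ≥0} : s < gainInv γ t ↔ γ s < t := by
  rw [← hγ.strictMono.lt_iff_lt, hγ.apply_gainInv]

theorem pos (hγ : IsKInf γ) {s : ℝ≥0} (hs : 0 < s) : 0 < γ s := by
  simpa [hγ.map_zero] using hγ.strictMono hs

theorem gainInv (hγ : IsKInf γ) : IsKInf (gainInv γ) := by
  have hmono : StrictMono (_root_.gainInv γ) := fun s t hst => by
    rwa [hγ.lt_gainInv_iff, hγ.apply_gainInv]
  have hsurj : Function.Surjective (_root_.gainInv γ) := fun s =>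
    ⟨γ s, hγ.strictMono.injective (hγ.apply_gainInv _)⟩
  refine ⟨hmono.monotone.continuous_of_surjective hsurj, hmono, ?_, ?_⟩
  · exact hγ.strictMono.injective (by rw [hγ.apply_gainInv, hγ.map_zero])
  · rw [hsurj.range_eq]
    exact not_bddAbove_univ

/-- The mean of two gains is again a gain. -/
theorem mean (hγ : IsKInf γ) (hδ : IsKInf δ) : IsKInf fun s => (γ s + δ s) / 2 := by
  have hmono : StrictMono fun s => (γ s + δ s) / 2 := fun s t hst =>
    (div_lt_div_iff_of_pos_right two_pos).2 (add_lt_add (hγ.strictMono hst) (hδ.strictMono hst))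
  refine ⟨by have := hγ.continuous; have := hδ.continuous; fun_prop, hmono,
    by simp [hγ.map_zero, hδ.map_zero], ?_⟩
  rw [not_bddAbove_iff]
  intro s
  obtain ⟨t, ht⟩ := hγ.surjective (2 * s + 1)
  refine ⟨_, ⟨t, rfl⟩, ?_⟩
  have h : 2 * s < γ t + δ t := by
    rw [ht]
    exact (lt_add_one _).trans_le le_self_add
  rw [lt_div_iff₀ two_pos]
  linarith

end IsKInf

/-- The mean of `δ` and `γ⁻¹` lies strictly between them wherever `γ ∘ δ < id`. -/
theorem SmallGainOn.mean_gainInv {γ δ : ℝ≥0 → ℝ≥0} (hγ : IsKInf γ) (hδ : IsKInf δ) {I : Set ℝ≥0}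
    (h : ∀ s ∈ I, γ (δ s) < s) : SmallGainOn γ δ (fun s => (δ s + gainInv γ s) / 2) I := by
  refine ⟨hδ.mean hγ.gainInv, h, fun s hs => ?_, fun s hs => ?_⟩
  · have := hγ.lt_gainInv_iff.2 (h s hs)
    rw [lt_div_iff₀ two_pos]
    linarith
  · have := hγ.lt_gainInv_iff.2 (h s hs)
    rw [div_lt_iff₀ two_pos]
    linarith

/-- The limits of `γ (δ s) / s` at `0` and at `∞` being less than `1` yield the small-gain
condition near `0` and near `∞`. -/
theorem exists_smallGainOn {γ δ : ℝ≥0 → ℝ≥0} (hγ : IsKInf γ) (hδ : IsKInf δ)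
    (hzero : ∃ L : ℝ≥0, L < 1 ∧ Tendsto (fun s : ℝ≥0 => γ (δ s) / s) (𝓝[>] 0) (𝓝 L))
    (hinfty : ∃ L : ℝ≥0, L < 1 ∧ Tendsto (fun s : ℝ≥0 => γ (δ s) / s) atTop (𝓝 L)) :
    ∃ (σl σg : ℝ≥0 → ℝ≥0) (Ml Nl Mg Ng : ℝ≥0), 0 < Ml ∧ 0 < Nl ∧ Ml < Mg ∧
      SmallGainOn γ δ σl (Set.Ioc 0 Ml) ∧ SmallGainOn γ δ σg (Set.Ici Mg) := by
  obtain ⟨L, hL, h0⟩ := hzero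
  obtain ⟨L', hL', hi⟩ := hinfty
  have key : ∀ s : ℝ≥0, 0 < s → γ (δ s) / s < 1 → γ (δ s) < s := fun s hs h => by
    rwa [div_lt_one hs] at h
  obtain ⟨M, hM, hMs⟩ := mem_nhdsGT_iff_exists_Ioc_subset.1 (h0.eventually_lt_const hL)
  obtain ⟨M', hM'⟩ := eventually_atTop.1 (hi.eventually_lt_const hL')
  have hM : 0 < M := hM
  refine ⟨_, _, M, 1, max M' (M + 1), 0, hM, one_pos, lt_max_of_lt_right (lt_add_one M),
    SmallGainOn.mean_gainInv hγ hδ fun s hs => key s hs.1 (hMs hs),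
    SmallGainOn.mean_gainInv hγ hδ fun s hs => key s ?_ (hM' s ((le_max_left _ _).trans hs))⟩
  exact (hM.trans (lt_add_one M)).trans_le ((le_max_right _ _).trans hs)

/-! ### Upper right Dini derivatives along curves -/

/-- The upper right Dini derivative at `t` of the real function `u` is at most `c`. -/
def UpperDiniLE (u : ℝ → ℝ) (c t : ℝ) : Prop :=
  ∀ r, c < r → ∀ᶠ s in 𝓝[>] t, (s - t)⁻¹ * (u s - u t) < r

namespace UpperDiniLE

variable {u u' : ℝ → ℝ} {c c' t : ℝ}

theorem mono (h : UpperDiniLE u c t) (hc : c ≤ c') : UpperDiniLE u c' t :=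
  fun r hr => h r (hc.trans_lt hr)

theorem add (h : UpperDiniLE u c t) (h' : UpperDiniLE u' c' t) :
    UpperDiniLE (fun s => u s + u' s) (c + c') t := by
  intro r hr
  filter_upwards [h (c + (r - (c + c')) / 2) (by linarith),
    h' (c' + (r - (c + c')) / 2) (by linarith)] with s hs hs'
  have : (s - t)⁻¹ * (u s + u' s - (u t + u' t))
      = (s - t)⁻¹ * (u s - u t) + (s - t)⁻¹ * (u' s - u' t) := by ring
  linarith

theorem eventually_lt (h : UpperDiniLE u c t) (hc : c < 0) : ∀ᶠ s in 𝓝[>] t, u s < u t := by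
  filter_upwards [h 0 hc, self_mem_nhdsWithin] with s hs hst
  have : 0 < (s - t)⁻¹ := inv_pos.2 (sub_pos.2 hst)
  by_contra! hle
  exact absurd hs (not_lt.2 (mul_nonneg this.le (sub_nonneg.2 hle)))

/-- Grönwall's inequality for a differential inequality `D⁺u ≤ K u + b`. -/
theorem le_gronwallBound {K b a : ℝ} (hu : ContinuousOn u (Set.Ici a))
    (h : ∀ s, a ≤ s → UpperDiniLE u (K * u s + b) s) {s : ℝ} (hs : a ≤ s) :
    u s ≤ gronwallBound (u a) K b (s - a) :=
  le_gronwallBound_of_liminf_deriv_right_le (f' := fun x => K * u x + b)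
    (hu.mono Set.Icc_subset_Ici_self) (fun x hx r hr => (h x hx.1 r hr).frequently) le_rfl
    (fun _ _ => le_rfl) s ⟨hs, le_rfl⟩

/-- If `D⁺u ≤ -u + b` eventually, then `limsup u ≤ b`. -/
theorem eventually_lt_of_neg_add {b : ℝ} {a : ℝ} (hu : ContinuousOn u (Set.Ici a))
    (h : ∀ s, a ≤ s → UpperDiniLE u (-u s + b) s) {r : ℝ} (hr : b < r) :
    ∀ᶠ s in atTop, u s < r := by
  have hlim : Tendsto (fun s => gronwallBound (u a) (-1) b (s - a)) atTop (𝓝 b) := by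
    have hexp : Tendsto (fun s => Real.exp (-1 * (s - a))) atTop (𝓝 0) := by
      refine Real.tendsto_exp_atBot.comp ?_
      have : Tendsto (fun s : ℝ => s - a) atTop atTop := tendsto_atTop_add_const_right _ _ tendsto_id
      exact (tendsto_neg_atTop_atBot.comp this).congr fun s => by simp
    rw [gronwallBound_of_K_ne_0 (by norm_num)]
    have := (hexp.const_mul (u a)).add ((hexp.sub_const 1).const_mul (b / (-1)))
    rwa [show u a * 0 + b / -1 * (0 - 1) = b by ring] at this
  filter_upwards [hlim.eventually_lt_const hr, eventually_ge_atTop a] with s hs has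
  exact (le_gronwallBound hu (fun s hs => by simpa using h s hs) has).trans_lt hs

end UpperDiniLE

/-- For a locally Lipschitz function, the Dini derivative in the direction of the velocity of a
curve bounds the Dini derivative along the curve. -/
theorem upperDiniLE_comp_of_diniDeriv_le {E : Type*} [NormedAddCommGroup E] [NormedSpace ℝ E]
    {φ : E → ℝ≥0} (hφ : LocallyLipschitz φ) {Y : ℝ → E} {v : E} {t c : ℝ}
    (hY : HasDerivWithinAt Y v (Set.Ici t) t) (h : diniDeriv φ v (Y t) ≤ (c : EReal)) :
    UpperDiniLE (fun s => (φ (Y s) : ℝ)) c t := by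
  intro r hr
  obtain ⟨r', hcr', hr'⟩ := exists_between hr
  obtain ⟨K, s, hs, hK⟩ := hφ (Y t)
  have hlt : diniDeriv φ v (Y t) < (r' : EReal) := h.trans_lt (EReal.coe_lt_coe_iff.2 hcr')
  have h1 := eventually_lt_of_limsup_lt hlt
  have hshift : Tendsto (fun z : ℝ => z - t) (𝓝[>] t) (𝓝[>] 0) := by
    refine tendsto_nhdsWithin_iff.2 ⟨?_, ?_⟩
    · refine Tendsto.mono_left ?_ nhdsWithin_le_nhds
      exact (continuous_id.sub continuous_const).tendsto' _ _ (by simp)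
    · filter_upwards [self_mem_nhdsWithin] with z hz
      exact sub_pos.2 (Set.mem_Ioi.1 hz)
  have h2 := hshift.eventually h1
  have hcont : Tendsto Y (𝓝[>] t) (𝓝 (Y t)) :=
    hY.continuousWithinAt.mono Set.Ioi_subset_Ici_self
  have hcont' : Tendsto (fun z : ℝ => Y t + (z - t) • v) (𝓝[>] t) (𝓝 (Y t)) := by
    refine Tendsto.mono_left ?_ nhdsWithin_le_nhds
    exact Continuous.tendsto' (by fun_prop) _ _ (by simp)
  have hε : 0 < (r - r') / (K + 1) := div_pos (sub_pos.2 hr') (by positivity)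
  have h3 := (hasDerivWithinAt_iff_isLittleO.1 hY).def hε
  have h3 := h3.filter_mono (nhdsWithin_mono t Set.Ioi_subset_Ici_self)
  filter_upwards [h2, h3, hcont hs, hcont' hs, self_mem_nhdsWithin] with z hz2 hz3 hz4 hz5 hz
  have hpos : 0 < z - t := sub_pos.2 hz
  have hlip := hK.dist_le_mul _ hz4 _ hz5
  rw [NNReal.dist_eq, dist_eq_norm] at hlip
  have he : Y z - (Y t + (z - t) • v) = Y z - Y t - (z - t) • v := by abel
  rw [he] at hlip
  rw [EReal.coe_lt_coe_iff, div_lt_iff₀ hpos] at hz2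
  rw [Real.norm_eq_abs, abs_of_pos hpos] at hz3
  have hz6 : (φ (Y z) : ℝ) - φ (Y t + (z - t) • v) ≤ (r - r') * (z - t) := by
    calc (φ (Y z) : ℝ) - φ (Y t + (z - t) • v) ≤ K * ‖Y z - Y t - (z - t) • v‖ :=
          (le_abs_self _).trans hlip
      _ ≤ (K + 1) * ((r - r') / (K + 1) * (z - t)) := by
          gcongr
          linarith
      _ = (r - r') * (z - t) := by field_simp
  rw [inv_mul_lt_iff₀ hpos]
  nlinarith

/-! ### Scalar small-gain comparison -/

/-- A box `[0, p] × [0, q]` with `γ q < p` and `δ p < q` is forward invariant for a pair of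
functions which satisfies the coupled differential inequalities while it is in the box. -/
theorem forall_le_of_upperDiniLE {γ δ : ℝ≥0 → ℝ≥0} (hγ : Monotone γ) (hδ : Monotone δ)
    {v w : ℝ → ℝ≥0} (hv : ContinuousOn v (Set.Ici 0)) (hw : ContinuousOn w (Set.Ici 0))
    {p q : ℝ≥0} (hp : γ q < p) (hq : δ p < q) (hv0 : v 0 ≤ p) (hw0 : w 0 ≤ q)
    (hDv : ∀ t, 0 ≤ t → v t ≤ p → w t ≤ q →
      UpperDiniLE (fun s => (v s : ℝ)) (-(v t : ℝ) + γ (w t)) t)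
    (hDw : ∀ t, 0 ≤ t → v t ≤ p → w t ≤ q →
      UpperDiniLE (fun s => (w s : ℝ)) (-(w t : ℝ) + δ (v t)) t)
    {t : ℝ} (ht : 0 ≤ t) : v t ≤ p ∧ w t ≤ q := by
  -- On the boundary of the box the outward derivative is negative; inside, continuity suffices.
  have aux : ∀ (u : ℝ → ℝ≥0) (a b : ℝ≥0) (x : ℝ), ContinuousOn u (Set.Ici 0) → 0 ≤ x → u x ≤ a →
      b < a → UpperDiniLE (fun s => (u s : ℝ)) (-(u x : ℝ) + b) x → ∀ᶠ s in 𝓝[>] x, u s ≤ a := by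
    intro u a b x hu hx hua hba hD
    rcases hua.lt_or_eq with hlt | heq
    · have : Tendsto u (𝓝[>] x) (𝓝 (u x)) :=
        (hu x hx).mono (Set.Ioi_subset_Ici_self.trans (Set.Ici_subset_Ici.2 hx))
      exact (this.eventually_lt_const hlt).mono fun _ h => h.le
    · have hneg : -(u x : ℝ) + b < 0 := by
        have : (b : ℝ) < a := hba
        rw [heq]
        linarith
      exact (hD.eventually_lt hneg).mono fun s hs => (NNReal.coe_lt_coe.1 hs).le.trans hua
  have hclosed : IsClosed ({s | v s ≤ p ∧ w s ≤ q} ∩ Set.Icc 0 t) := by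
    have h1 := (hv.mono (Set.Icc_subset_Ici_self : Set.Icc 0 t ⊆ _)).prodMk
      (hw.mono (Set.Icc_subset_Ici_self : Set.Icc 0 t ⊆ _))
    have := h1.preimage_isClosed_of_isClosed isClosed_Icc (isClosed_Iic.prod isClosed_Iic)
      (t := Set.Iic p ×ˢ Set.Iic q)
    rwa [Set.inter_comm] at this
  refine hclosed.Icc_subset_of_forall_mem_nhdsWithin ⟨hv0, hw0⟩ ?_ ⟨ht, le_rfl⟩
  rintro x ⟨⟨hvx, hwx⟩, hx, -⟩
  exact (aux v p _ x hv hx hvx ((hγ hwx).trans_lt hp) (hDv x hx hvx hwx)).and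
    (aux w q _ x hw hx hwx ((hδ hvx).trans_lt hq) (hDw x hx hvx hwx))

/-- The upper limits `a` and `b` of a bounded solution of the coupled differential inequalities
satisfy `a ≤ γ b` and `b ≤ δ a`. -/
theorem exists_upper_limits {γ δ : ℝ≥0 → ℝ≥0} (hγ : IsKInf γ) (hδ : IsKInf δ)
    {v w : ℝ → ℝ≥0} {t₀ : ℝ} (hv : ContinuousOn v (Set.Ici t₀)) (hw : ContinuousOn w (Set.Ici t₀))
    {p q : ℝ≥0} (hp : ∀ t, t₀ ≤ t → v t ≤ p) (hq : ∀ t, t₀ ≤ t → w t ≤ q)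
    (hDv : ∀ t, t₀ ≤ t → UpperDiniLE (fun s => (v s : ℝ)) (-(v t : ℝ) + γ (w t)) t)
    (hDw : ∀ t, t₀ ≤ t → UpperDiniLE (fun s => (w s : ℝ)) (-(w t : ℝ) + δ (v t)) t) :
    ∃ a b : ℝ≥0, a ≤ p ∧ a ≤ γ b ∧ b ≤ δ a ∧ (∀ r, a < r → ∀ᶠ t in atTop, v t < r) ∧
      ∀ r, b < r → ∀ᶠ t in atTop, w t < r := by
  have hbdd : ∀ (u : ℝ → ℝ≥0) (c : ℝ≥0), (∀ t, t₀ ≤ t → u t ≤ c) →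
      IsBoundedUnder (· ≤ ·) atTop u := fun u c hc =>
    isBoundedUnder_of_eventually_le ((eventually_ge_atTop t₀).mono hc)
  have hco : ∀ u : ℝ → ℝ≥0, IsCoboundedUnder (· ≤ ·) atTop u := fun u => by isBoundedDefault
  -- One half of the conclusion, used for both components.
  have half : ∀ (η : ℝ≥0 → ℝ≥0) (x y : ℝ → ℝ≥0) (c : ℝ≥0), IsKInf η → ContinuousOn x (Set.Ici t₀) →
      (∀ t, t₀ ≤ t → y t ≤ c) →
      (∀ t, t₀ ≤ t → UpperDiniLE (fun s => (x s : ℝ)) (-(x t : ℝ) + η (y t)) t) →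
      limsup x atTop ≤ η (limsup y atTop) := by
    intro η x y c hη hx hy hD
    have h1 : ∀ r, limsup y atTop < r → limsup x atTop ≤ η r := by
      intro r hr
      obtain ⟨T, hT⟩ := eventually_atTop.1 (eventually_lt_of_limsup_lt hr (hbdd y c hy))
      refine le_of_forall_gt_imp_ge_of_dense fun z hz => ?_
      refine limsup_le_of_le (hco x) ?_
      have := UpperDiniLE.eventually_lt_of_neg_add (u := fun s => (x s : ℝ)) (b := η r)
        (a := max t₀ T) (r := z)
        ((NNReal.continuous_coe.comp_continuousOn hx).mono (Set.Ici_subset_Ici.2 (le_max_left _ _)))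
        (fun s hs => (hD s ((le_max_left _ _).trans hs)).mono ?_) hz
      · exact this.mono fun s hs => (NNReal.coe_lt_coe.1 hs).le
      · have := hη.strictMono.monotone (hT s ((le_max_right _ _).trans hs)).le
        have : (η (y s) : ℝ) ≤ η r := this
        linarith
    have hlim : Tendsto η (𝓝[>] (limsup y atTop)) (𝓝 (η (limsup y atTop))) :=
      (hη.continuous.tendsto _).mono_left nhdsWithin_le_nhds
    exact ge_of_tendsto hlim (eventually_mem_nhdsWithin.mono h1)
  refine ⟨limsup v atTop, limsup w atTop,
    limsup_le_of_le (hco v) ((eventually_ge_atTop t₀).mono hp),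
    half γ v w q hγ hv hq hDv, half δ w v p hδ hw hp hDw,
    fun r hr => eventually_lt_of_limsup_lt hr (hbdd v p hp),
    fun r hr => eventually_lt_of_limsup_lt hr (hbdd w q hq)⟩

/-! ### Solutions of bounded Lipschitz fields -/

section ForwardSolution

variable {E : Type*} [NormedAddCommGroup E] [NormedSpace ℝ E] {h : E → E} {y y' : E} {Y Y' : ℝ → E}
  {K : ℝ≥0} {B : ℝ}

theorem IsForwardSolution.hasDerivWithinAt_Ici (hY : IsForwardSolution h y Y) {t : ℝ} (ht : 0 ≤ t) :
    HasDerivWithinAt Y (h (Y t)) (Set.Ici t) t :=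
  (hY.2 t ht).mono (Set.Ici_subset_Ici.2 ht)

theorem IsForwardSolution.continuousOn (hY : IsForwardSolution h y Y) :
    ContinuousOn Y (Set.Ici 0) :=
  fun t ht => (hY.2 t ht).continuousWithinAt

theorem IsForwardSolution.continuousOn_Icc (hY : IsForwardSolution h y Y) {a b : ℝ} (ha : 0 ≤ a) :
    ContinuousOn Y (Set.Icc a b) :=
  hY.continuousOn.mono fun _ ht => ha.trans ht.1

theorem IsForwardSolution.dist_le (hK : LipschitzWith K h) (hY : IsForwardSolution h y Y)
    (hY' : IsForwardSolution h y' Y') {t : ℝ} (ht : 0 ≤ t) :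
    dist (Y t) (Y' t) ≤ dist y y' * Real.exp (K * t) := by
  have := dist_le_of_trajectories_ODE (v := fun _ => h) (fun _ => hK)
    (hY.continuousOn_Icc le_rfl) (fun s hs => hY.hasDerivWithinAt_Ici hs.1)
    (hY'.continuousOn_Icc le_rfl) (fun s hs => hY'.hasDerivWithinAt_Ici hs.1)
    (by rw [hY.1, hY'.1]) t ⟨ht, le_rfl⟩
  simpa using this

theorem IsForwardSolution.eq (hK : LipschitzWith K h) (hY : IsForwardSolution h y Y)
    (hY' : IsForwardSolution h y Y') {t : ℝ} (ht : 0 ≤ t) : Y t = Y' t := by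
  have := hY.dist_le hK hY' ht
  rw [dist_self, zero_mul] at this
  exact dist_le_zero.1 this

/-- Since the field is bounded, the Picard–Lindelöf theorem applies on every interval `[0, T]`;
by uniqueness the resulting solutions fit together. -/
theorem exists_isForwardSolution [CompleteSpace E] (hK : LipschitzWith K h)
    (hB : ∀ y, ‖h y‖ ≤ B) (y : E) : ∃ Y, IsForwardSolution h y Y := by
  have hB0 : 0 ≤ B := (norm_nonneg _).trans (hB 0)
  lift B to ℝ≥0 using hB0
  have hex : ∀ T : ℕ, ∃ α : ℝ → E, α 0 = y ∧
      ∀ t ∈ Set.Icc (0 : ℝ) T, HasDerivWithinAt α (h (α t)) (Set.Icc 0 T) t := by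
    intro T
    have hpl : IsPicardLindelof (fun _ => h) (tmin := 0) (tmax := T)
        ⟨0, le_rfl, Nat.cast_nonneg T⟩ y (B * T) 0 B K :=
      IsPicardLindelof.of_time_independent (fun x _ => hB x) hK.lipschitzOnWith (by simp)
    exact hpl.exists_eq_forall_mem_Icc_hasDerivWithinAt₀
  choose α hα0 hα using hex
  have hder : ∀ (T : ℕ) (t : ℝ), t ∈ Set.Ico (0 : ℝ) T →
      HasDerivWithinAt (α T) (h (α T t)) (Set.Ici 0) t := fun T t ht =>
    (hα T t ⟨ht.1, ht.2.le⟩).mono_of_mem_nhdsWithin <| by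
      rw [← Set.Ici_inter_Iic]
      exact inter_mem self_mem_nhdsWithin (mem_nhdsWithin_of_mem_nhds (Iic_mem_nhds ht.2))
  have hagree : ∀ (T T' : ℕ) (t : ℝ), 0 ≤ t → t ≤ T → t ≤ T' → α T t = α T' t := by
    intro T T' t ht hT hT'
    have hc : ∀ S : ℕ, t ≤ S → ContinuousOn (α S) (Set.Icc 0 t) := fun S hS s hs =>
      ((hα S s ⟨hs.1, hs.2.trans hS⟩).continuousWithinAt).mono (Set.Icc_subset_Icc_right hS)
    have hd : ∀ S : ℕ, t ≤ S → ∀ s ∈ Set.Ico 0 t,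
        HasDerivWithinAt (α S) (h (α S s)) (Set.Ici s) s := fun S hS s hs =>
      (hder S s ⟨hs.1, hs.2.trans_le hS⟩).mono (Set.Ici_subset_Ici.2 hs.1)
    exact ODE_solution_unique (v := fun _ => h) (fun _ => hK) (hc T hT) (hd T hT) (hc T' hT')
      (hd T' hT') (by rw [hα0, hα0]) ⟨ht, le_rfl⟩
  have hceil : ∀ t : ℝ, t < ((⌈t⌉₊ + 1 : ℕ) : ℝ) := fun t => by
    push_cast
    linarith [Nat.le_ceil t]
  refine ⟨fun t => α (⌈t⌉₊ + 1) t, hα0 _, fun t ht => ?_⟩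
  refine (hder _ t ⟨ht, hceil t⟩).congr_of_eventuallyEq ?_ rfl
  filter_upwards [self_mem_nhdsWithin, mem_nhdsWithin_of_mem_nhds (Iio_mem_nhds (hceil t))]
    with s hs hst
  exact hagree _ _ s hs (hceil s).le hst.le

theorem IsForwardSolution.norm_sub_le (hB : ∀ y, ‖h y‖ ≤ B) (hY : IsForwardSolution h y Y)
    {s t : ℝ} (hs : 0 ≤ s) (hst : s ≤ t) : ‖Y t - Y s‖ ≤ B * (t - s) :=
  norm_image_sub_le_of_norm_deriv_right_le_segment (hY.continuousOn_Icc hs)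
    (fun _ hx => hY.hasDerivWithinAt_Ici (hs.trans hx.1)) (fun _ _ => hB _) t ⟨hst, le_rfl⟩

/-! ### The Euler scheme -/

/-- One step of length `τ` of the explicit Euler scheme for `ẏ = h(y)`. -/
def eulerStep (h : E → E) (τ : ℝ) (y : E) : E := y + τ • h y

theorem norm_eulerStep_sub_le (hK : LipschitzWith K h) {τ : ℝ} (hτ : 0 ≤ τ) (a b : E) :
    ‖eulerStep h τ a - eulerStep h τ b‖ ≤ (1 + K * τ) * ‖a - b‖ := by
  have : eulerStep h τ a - eulerStep h τ b = (a - b) + τ • (h a - h b) := by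
    simp only [eulerStep, smul_sub]
    abel
  rw [this]
  refine (norm_add_le _ _).trans ?_
  rw [norm_smul, Real.norm_of_nonneg hτ]
  have := hK.norm_sub_le a b
  nlinarith

theorem eulerStep_injective (hK : LipschitzWith K h) {τ : ℝ} (hτ : 0 ≤ τ) (hKτ : K * τ < 1) :
    Function.Injective (eulerStep h τ) := by
  intro a b hab
  have h1 : a - b = -(τ • (h a - h b)) := by
    have : a + τ • h a = b + τ • h b := hab
    rw [smul_sub, neg_sub, sub_eq_sub_iff_add_eq_add, this, add_comm]
  have h2 : ‖a - b‖ ≤ τ * (K * ‖a - b‖) := by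
    conv_lhs => rw [h1, norm_neg, norm_smul, Real.norm_of_nonneg hτ]
    exact mul_le_mul_of_nonneg_left (hK.norm_sub_le a b) hτ
  have h3 : ‖a - b‖ ≤ 0 := by nlinarith [norm_nonneg (a - b)]
  exact sub_eq_zero.1 (norm_le_zero_iff.1 h3)

/-- The local error of the Euler scheme. -/
theorem IsForwardSolution.norm_sub_eulerStep_le (hK : LipschitzWith K h) (hB : ∀ y, ‖h y‖ ≤ B)
    (hY : IsForwardSolution h y Y) {s τ : ℝ} (hs : 0 ≤ s) (hτ : 0 ≤ τ) :
    ‖Y (s + τ) - eulerStep h τ (Y s)‖ ≤ K * B * τ ^ 2 := by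
  have hder : ∀ x ∈ Set.Ico s (s + τ),
      HasDerivWithinAt (fun x => Y x - x • h (Y s)) (h (Y x) - h (Y s)) (Set.Ici x) x :=
    fun x hx => by
      have := (hY.hasDerivWithinAt_Ici (hs.trans hx.1)).sub
        ((hasDerivWithinAt_id x (Set.Ici x)).smul_const (h (Y s)))
      rwa [one_smul] at this
  have hB0 : 0 ≤ B := (norm_nonneg _).trans (hB 0)
  have := norm_image_sub_le_of_norm_deriv_right_le_segment (C := K * (B * τ))
    (ContinuousOn.fun_sub (hY.continuousOn_Icc hs) (by fun_prop)) hder (fun x hx => ?_) (s + τ)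
    ⟨by linarith, le_rfl⟩
  · have he : Y (s + τ) - (s + τ) • h (Y s) - (Y s - s • h (Y s))
        = Y (s + τ) - eulerStep h τ (Y s) := by
      simp only [eulerStep, add_smul]
      abel
    rw [he] at this
    refine this.trans (le_of_eq ?_)
    ring
  · refine (hK.norm_sub_le _ _).trans ?_
    gcongr
    refine (hY.norm_sub_le hB hs hx.1).trans ?_
    gcongr
    linarith [hx.2]

/-- The global error of the Euler scheme. -/
theorem IsForwardSolution.norm_eulerStep_iterate_sub_le (hK : LipschitzWith K h)
    (hB : ∀ y, ‖h y‖ ≤ B) (hY : IsForwardSolution h y Y) {τ : ℝ} (hτ : 0 ≤ τ) (k : ℕ) :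
    ‖(eulerStep h τ)^[k] y - Y (k * τ)‖ ≤ K * B * τ ^ 2 * k * Real.exp (K * (k * τ)) := by
  have hB0 : 0 ≤ B := (norm_nonneg _).trans (hB 0)
  induction k with
  | zero => simp [hY.1]
  | succ k ih =>
    have hkτ : 0 ≤ k * τ := by positivity
    have h1 := norm_eulerStep_sub_le hK hτ ((eulerStep h τ)^[k] y) (Y (k * τ))
    have h2 := hY.norm_sub_eulerStep_le hK hB hkτ hτ
    have he : ((k + 1 : ℕ) : ℝ) * τ = k * τ + τ := by
      push_cast
      ring
    rw [he, Function.iterate_succ_apply']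
    have h3 := norm_sub_le_norm_sub_add_norm_sub (eulerStep h τ ((eulerStep h τ)^[k] y))
      (eulerStep h τ (Y (k * τ))) (Y (k * τ + τ))
    rw [norm_sub_rev (eulerStep h τ (Y (k * τ)))] at h3
    have h4 : 1 + K * τ ≤ Real.exp (K * τ) := by
      rw [add_comm]
      exact Real.add_one_le_exp _
    have h5 : (1 : ℝ) ≤ Real.exp (K * (k * τ + τ)) := Real.one_le_exp (by positivity)
    have h6 : Real.exp (K * (k * τ + τ)) = Real.exp (K * τ) * Real.exp (K * (k * τ)) := by
      rw [← Real.exp_add]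
      ring_nf
    calc _ ≤ (1 + K * τ) * ‖(eulerStep h τ)^[k] y - Y (k * τ)‖ + K * B * τ ^ 2 := by linarith
      _ ≤ Real.exp (K * τ) * (K * B * τ ^ 2 * k * Real.exp (K * (k * τ)))
          + K * B * τ ^ 2 * Real.exp (K * (k * τ + τ)) := by
        have h7 : K * B * τ ^ 2 ≤ K * B * τ ^ 2 * Real.exp (K * (k * τ + τ)) :=
          le_mul_of_one_le_right (by positivity) h5
        gcongr
      _ = _ := by
        rw [h6]
        push_cast
        ring

theorem differentiable_eulerStep (hh : ContDiff ℝ 1 h) (τ : ℝ) :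
    Differentiable ℝ (eulerStep h τ) :=
  differentiable_id.add ((hh.differentiable one_ne_zero).const_smul τ)

theorem fderiv_eulerStep (hh : ContDiff ℝ 1 h) (τ : ℝ) (y : E) :
    fderiv ℝ (eulerStep h τ) y = 1 + τ • fderiv ℝ h y :=
  ((hasFDerivAt_id y).add
    ((hh.differentiable one_ne_zero y).hasFDerivAt.const_smul τ)).fderiv

theorem det_fderiv_iterate {e : E → E} (he : Differentiable ℝ e) (y : E) (k : ℕ) :
    (fderiv ℝ e^[k] y).det = ∏ i ∈ Finset.range k, (fderiv ℝ e (e^[i] y)).det := by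
  induction k with
  | zero =>
    rw [Function.iterate_zero, fderiv_id, Finset.prod_range_zero]
    exact LinearMap.det_id
  | succ k ih =>
    rw [Function.iterate_succ', fderiv_comp _ (he _) (he.iterate k y), Finset.prod_range_succ, ← ih,
      mul_comm]
    simp [ContinuousLinearMap.det]

end ForwardSolution

/-! ### Volume expansion along a flow -/

section Volume

variable {E : Type*} [NormedAddCommGroup E] [NormedSpace ℝ E] [FiniteDimensional ℝ E] {h : E → E}

/-- The trace as a continuous linear functional on the continuous endomorphisms. -/
noncomputable def traceCLM (E : Type*) [NormedAddCommGroup E] [NormedSpace ℝ E]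
    [FiniteDimensional ℝ E] : (E →L[ℝ] E) →L[ℝ] ℝ :=
  LinearMap.toContinuousLinearMap (LinearMap.trace ℝ E ∘ₗ ContinuousLinearMap.coeLM ℝ)

theorem traceCLM_fderiv (h : E → E) (y : E) : traceCLM E (fderiv ℝ h y) = divergence h y := rfl

theorem continuous_divergence (hh : ContDiff ℝ 1 h) : Continuous (divergence h) :=
  (traceCLM E).continuous.comp (hh.continuous_fderiv one_ne_zero)

/-- The derivative of the determinant at the identity is the trace. -/
theorem hasFDerivAt_det_one_add :
    HasFDerivAt (fun A : E →L[ℝ] E => (1 + A).det) (traceCLM E) 0 := by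
  classical
  let b := Module.finBasis ℝ E
  let M : (E →L[ℝ] E) →ₗ[ℝ] Matrix (Fin (Module.finrank ℝ E)) (Fin (Module.finrank ℝ E)) ℝ :=
    (LinearMap.toMatrix b b).toLinearMap ∘ₗ ContinuousLinearMap.coeLM ℝ
  have hdet : ∀ A : E →L[ℝ] E, (1 + A).det = (1 + M A).det := fun A => by
    have : 1 + M A = LinearMap.toMatrix b b ((1 + A : E →L[ℝ] E) : E →ₗ[ℝ] E) := by
      rw [ContinuousLinearMap.toLinearMap_add, map_add, ContinuousLinearMap.one_def,
        ContinuousLinearMap.coe_id, LinearMap.toMatrix_id]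
      rfl
    rw [this, LinearMap.det_toMatrix]
  have hentry : ∀ i j, Differentiable ℝ fun A => M A i j := fun i j => by
    let ev : (E →L[ℝ] E) →ₗ[ℝ] ℝ := Matrix.entryLinearMap ℝ ℝ i j ∘ₗ M
    exact (LinearMap.toContinuousLinearMap ev).differentiable
  have hdiff : DifferentiableAt ℝ (fun A : E →L[ℝ] E => (1 + A).det) 0 := by
    simp only [hdet, Matrix.det_apply, Matrix.add_apply]
    refine DifferentiableAt.fun_sum fun σ _ => DifferentiableAt.const_smul ?_ _
    refine (HasFDerivAt.finsetProd fun i _ => DifferentiableAt.hasFDerivAt ?_).differentiableAt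
    exact (differentiableAt_const _).fun_add (hentry _ _ _)
  convert hdiff.hasFDerivAt using 1
  ext A
  -- The directional derivative is read off from the expansion of `det (1 + t A)` in powers of `t`.
  have hline : HasDerivAt (fun t : ℝ => (1 + t • A).det)
      (fderiv ℝ (fun A : E →L[ℝ] E => (1 + A).det) 0 A) 0 := by
    have h0 : HasDerivAt (fun t : ℝ => t • A) A 0 := by
      simpa using (hasDerivAt_id (0 : ℝ)).smul_const A
    exact HasFDerivAt.comp_hasDerivAt_of_eq (0 : ℝ) hdiff.hasFDerivAt h0 (zero_smul ℝ A).symm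
  have hline' : HasDerivAt (fun t : ℝ => (1 + t • A).det) (traceCLM E A) 0 := by
    have htr : traceCLM E A = (M A).trace := LinearMap.trace_eq_matrix_trace ℝ b _
    simp_rw [hdet, map_smul]
    rw [funext fun t : ℝ => Matrix.det_one_add_smul t (M A)]
    generalize (1 + (Polynomial.X : Polynomial ℝ) • (M A).map Polynomial.C).det.divX.divX = P
    have h1 := (((hasDerivAt_id (0 : ℝ)).const_mul (M A).trace).const_add 1).add
      ((P.hasDerivAt 0).mul (hasDerivAt_pow 2 (0 : ℝ)))
    rw [htr]
    refine (h1.congr_deriv ?_).congr_of_eventuallyEq (Eventually.of_forall fun _ => rfl)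
    simp
  exact hline'.unique hline

/-- A lower bound for the determinant near the identity, uniform over all directions. -/
theorem exists_exp_le_det_one_add {ε : ℝ} (hε : 0 < ε) :
    ∃ η > 0, ∀ A : E →L[ℝ] E, ‖A‖ < η → Real.exp (traceCLM E A - ε * ‖A‖) ≤ (1 + A).det := by
  have h0 : ((1 : E →L[ℝ] E) + 0).det = 1 := by
    rw [add_zero]
    exact LinearMap.det_id
  have hd := hasFDerivAt_det_one_add (E := E)
  have hlog := hd.log (by rw [h0]; exact one_ne_zero)
  have hpos : ∀ᶠ A in 𝓝 (0 : E →L[ℝ] E), 0 < (1 + A).det :=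
    hd.continuousAt.eventually_const_lt (one_pos.trans_eq h0.symm)
  obtain ⟨η, hη, hball⟩ := Metric.eventually_nhds_iff.1
    (hpos.and ((hasFDerivAt_iff_isLittleO.1 hlog).def hε))
  refine ⟨η, hη, fun A hA => ?_⟩
  obtain ⟨hp, hb⟩ := hball (y := A) (by simpa using hA)
  rw [← Real.le_log_iff_exp_le hp]
  have := (abs_le.1 hb).1
  simp only [h0, Real.log_one, sub_zero, inv_one, one_smul] at this
  linarith

/-- The Jacobian determinant of `N` Euler steps covering `[0, t]` is at least the exponential of
the integral of the divergence along the solution, up to errors `ε₁` from the linearization of the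
determinant and `ε₂` from the oscillation of the divergence, when the step is small enough. -/
theorem exp_sub_le_det_fderiv_eulerStep_iterate (hh : ContDiff ℝ 1 h) {K : ℝ≥0} {B D : ℝ}
    (hK : LipschitzWith K h) (hB : ∀ y, ‖h y‖ ≤ B) (hD : ∀ y, ‖fderiv ℝ h y‖ ≤ D)
    {ε₁ ε₂ η₁ η₂ : ℝ} (hε₁ : 0 ≤ ε₁)
    (hη₁ : ∀ A : E →L[ℝ] E, ‖A‖ < η₁ → Real.exp (traceCLM E A - ε₁ * ‖A‖) ≤ (1 + A).det)
    (hη₂ : ∀ a b : E, dist a b < η₂ → dist (divergence h a) (divergence h b) < ε₂)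
    {t τ : ℝ} {N : ℕ} (hτ : 0 ≤ τ) (ht : N * τ = t) (h₁ : D * τ < η₁)
    (h₂ : (K * B * t * Real.exp (K * t) + B) * τ < η₂)
    {y : E} {Y : ℝ → E} (hY : IsForwardSolution h y Y) :
    Real.exp ((∫ s in (0 : ℝ)..t, divergence h (Y s)) - (ε₂ + ε₁ * D) * t) ≤
      (fderiv ℝ (eulerStep h τ)^[N] y).det := by
  have hB0 : 0 ≤ B := (norm_nonneg _).trans (hB 0)
  have ht0 : 0 ≤ t := by
    rw [← ht]
    positivity
  have hcont : ContinuousOn (fun s => divergence h (Y s)) (Set.Ici 0) :=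
    (continuous_divergence hh).comp_continuousOn hY.continuousOn
  have hint : ∀ a b : ℝ, 0 ≤ a → a ≤ b →
      IntervalIntegrable (fun s => divergence h (Y s)) volume a b := fun a b ha hab =>
    ContinuousOn.intervalIntegrable_of_Icc hab (hcont.mono fun s hs => ha.trans hs.1)
  -- Along each step the integrand is close to its value at the corresponding Euler node.
  have hstep : ∀ k < N, (∫ s in (k * τ : ℝ)..((k + 1 : ℕ) * τ : ℝ), divergence h (Y s))
      - (ε₂ + ε₁ * D) * τ ≤ traceCLM E (τ • fderiv ℝ h ((eulerStep h τ)^[k] y))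
        - ε₁ * ‖τ • fderiv ℝ h ((eulerStep h τ)^[k] y)‖ := by
    intro k hk
    have hkτ : 0 ≤ k * τ := by positivity
    have hk1 : ((k + 1 : ℕ) : ℝ) * τ = k * τ + τ := by
      push_cast
      ring
    have hkt : k * τ ≤ t := by
      rw [← ht]
      gcongr
    set z := (eulerStep h τ)^[k] y
    have hclose : ∀ s ∈ Set.Icc (k * τ) ((k + 1 : ℕ) * τ),
        divergence h (Y s) ≤ divergence h z + ε₂ := by
      intro s hs
      have h3 := hY.norm_eulerStep_iterate_sub_le hK hB hτ k
      have h4 : ‖Y s - Y (k * τ)‖ ≤ B * τ := by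
        refine (hY.norm_sub_le hB hkτ hs.1).trans ?_
        gcongr
        linarith [hs.2]
      have h5 : K * B * τ ^ 2 * k * Real.exp (K * (k * τ))
          ≤ K * B * t * Real.exp (K * t) * τ := by
        calc K * B * τ ^ 2 * k * Real.exp (K * (k * τ))
            = K * B * (k * τ) * Real.exp (K * (k * τ)) * τ := by ring
          _ ≤ _ := by gcongr
      have h6 : dist (Y s) z < η₂ := by
        rw [dist_eq_norm]
        have := norm_sub_le_norm_sub_add_norm_sub (Y s) (Y (k * τ)) z
        rw [norm_sub_rev (Y (k * τ))] at this
        linarith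
      have := (abs_lt.1 (hη₂ _ _ h6)).2
      linarith
    have hI := intervalIntegral.integral_mono_on (a := k * τ) (b := (k + 1 : ℕ) * τ) (by linarith)
      (hint _ _ hkτ (by linarith)) intervalIntegrable_const hclose
    rw [intervalIntegral.integral_const, hk1, add_sub_cancel_left, smul_eq_mul] at hI
    rw [hk1, map_smul, traceCLM_fderiv, norm_smul, Real.norm_of_nonneg hτ, smul_eq_mul]
    have : ε₁ * (τ * ‖fderiv ℝ h z‖) ≤ ε₁ * (τ * D) := by
      gcongr
      exact hD z
    linarith
  rw [det_fderiv_iterate (differentiable_eulerStep hh τ)]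
  have hsum : (∫ s in (0 : ℝ)..t, divergence h (Y s)) - (ε₂ + ε₁ * D) * t
      = ∑ k ∈ Finset.range N, ((∫ s in (k * τ : ℝ)..((k + 1 : ℕ) * τ : ℝ), divergence h (Y s))
        - (ε₂ + ε₁ * D) * τ) := by
    rw [Finset.sum_sub_distrib, intervalIntegral.sum_integral_adjacent_intervals
      (a := fun k : ℕ => (k : ℝ) * τ), Finset.sum_const, Finset.card_range, nsmul_eq_mul, ← ht]
    · rw [Nat.cast_zero, zero_mul]
      ring
    · intro k _
      refine hint _ _ (by positivity) ?_
      gcongr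
      exact Nat.le_succ k
  rw [hsum]
  refine (Real.exp_le_exp.2
    (Finset.sum_le_sum fun k hk => hstep k (Finset.mem_range.1 hk))).trans ?_
  rw [Real.exp_sum]
  refine Finset.prod_le_prod (fun _ _ => (Real.exp_pos _).le) fun k _ => ?_
  rw [fderiv_eulerStep hh]
  refine hη₁ _ ?_
  rw [norm_smul, Real.norm_of_nonneg hτ, mul_comm]
  exact (mul_le_mul_of_nonneg_right (hD _) hτ).trans_lt h₁

/-- A volume estimate of Liouville type: if the integral of the divergence over `[0, t]` is at least
`a` along all solutions starting in `Z`, then the time-`t` map expands the volume of `Z` at least by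
the factor `exp a`, up to an arbitrarily small error. The time-`t` map is approximated uniformly by
iterates of Euler steps, to which the change of variables formula applies, so that no
differentiability of the flow is needed. -/
theorem ofReal_exp_mul_measure_le [MeasurableSpace E] [BorelSpace E] (μ : Measure E)
    [μ.IsAddHaarMeasure] (hh : ContDiff ℝ 1 h) (hcs : HasCompactSupport h) {Φ : E → ℝ → E}
    {Z S : Set E} (hZ : MeasurableSet Z) (hΦ : ∀ y ∈ Z, IsForwardSolution h y (Φ y)) {t : ℝ}
    (ht : 0 < t) (hS : ∀ y ∈ Z, Φ y t ∈ S) {a : ℝ}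
    (ha : ∀ y ∈ Z, a ≤ ∫ s in (0 : ℝ)..t, divergence h (Φ y s)) {ε : ℝ} (hε : 0 < ε) :
    ENNReal.ofReal (Real.exp (a - ε)) * μ Z ≤ μ (Metric.cthickening ε S) := by
  obtain ⟨K, hK⟩ := hh.lipschitzWith_of_hasCompactSupport hcs one_ne_zero
  obtain ⟨B, hB⟩ := hcs.exists_bound_of_continuous hh.continuous
  obtain ⟨D, hD⟩ := (hcs.fderiv ℝ).exists_bound_of_continuous (hh.continuous_fderiv one_ne_zero)
  have hB0 : 0 ≤ B := (norm_nonneg _).trans (hB 0)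
  have hD0 : 0 ≤ D := (norm_nonneg _).trans (hD 0)
  have hUC : UniformContinuous (divergence h) :=
    (traceCLM E).uniformContinuous.comp
      ((hcs.fderiv ℝ).uniformContinuous_of_continuous (hh.continuous_fderiv one_ne_zero))
  -- `ε₁` and `ε₂` are chosen such that the total error `(ε₂ + ε₁ D) t` is at most `ε`.
  have hε₁ : 0 < ε / (2 * t * (D + 1)) := by positivity
  have hε₂ : 0 < ε / (2 * t) := by positivity
  obtain ⟨η₁, hη₁, hdet⟩ := exists_exp_le_det_one_add (E := E) hε₁
  obtain ⟨η₂, hη₂, hdiv⟩ := Metric.uniformContinuous_iff.1 hUC _ hε₂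
  have herr : (ε / (2 * t) + ε / (2 * t * (D + 1)) * D) * t ≤ ε := by
    have h1 : ε / (2 * t) * t = ε / 2 := by field_simp
    have h2 : ε / (2 * t * (D + 1)) * D * t = ε / 2 * (D / (D + 1)) := by field_simp
    have h3 : D / (D + 1) ≤ 1 := (div_le_one (by positivity)).2 (by linarith)
    rw [add_mul, h1, h2]
    nlinarith
  have hsmall : ∀ c d : ℝ, 0 < d → ∀ᶠ N : ℕ in atTop, c * (t / N) < d := fun c d hd => by
    have := (tendsto_const_div_atTop_nhds_zero_nat t).const_mul c
    rw [mul_zero] at this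
    exact this.eventually_lt_const hd
  obtain ⟨N, hN1, hN2, hN3, hN4, hN⟩ := ((hsmall K 1 one_pos).and
    ((hsmall D η₁ hη₁).and ((hsmall (K * B * t * Real.exp (K * t) + B) η₂ hη₂).and
      ((hsmall (K * B * t * Real.exp (K * t)) ε hε).and (eventually_gt_atTop 0))))).exists
  have hN0 : (N : ℝ) ≠ 0 := Nat.cast_ne_zero.2 hN.ne'
  set τ := t / N with hτdef
  have hτ : 0 ≤ τ := by positivity
  have hNτ : N * τ = t := by
    rw [hτdef]
    field_simp
  have hinj : Set.InjOn (eulerStep h τ)^[N] Z :=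
    ((eulerStep_injective hK hτ hN1).iterate N).injOn
  have himage : (eulerStep h τ)^[N] '' Z ⊆ Metric.cthickening ε S := by
    rintro _ ⟨y, hy, rfl⟩
    refine Metric.mem_cthickening_of_dist_le _ _ _ _ (hS y hy) ?_
    have := (hΦ y hy).norm_eulerStep_iterate_sub_le hK hB hτ N
    rw [hNτ] at this
    rw [dist_eq_norm]
    refine this.trans (le_trans (le_of_eq ?_) hN4.le)
    rw [← hNτ]
    ring
  refine le_trans ?_ (measure_mono himage)
  rw [← lintegral_abs_det_fderiv_eq_addHaar_image μ hZ (fun y _ =>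
    ((differentiable_eulerStep hh τ).iterate N y).hasFDerivAt.hasFDerivWithinAt) hinj,
    ← setLIntegral_const]
  refine setLIntegral_mono' hZ fun y hy => ENNReal.ofReal_le_ofReal ?_
  have := exp_sub_le_det_fderiv_eulerStep_iterate hh hK hB hD hε₁.le hdet hdiv hτ hNτ hN2 hN3
    (hΦ y hy)
  refine le_trans (Real.exp_le_exp.2 ?_) (this.trans (le_abs_self _))
  linarith [ha y hy]

/-- A measurable set `Z` of initial values is null if its trajectories stay in a bounded set while
the integral of the divergence along them tends to infinity uniformly. -/
theorem measure_eq_zero_of_tendsto_integral_divergence [MeasurableSpace E] [BorelSpace E]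
    (μ : Measure E) [μ.IsAddHaarMeasure] (hh : ContDiff ℝ 1 h) (hcs : HasCompactSupport h)
    {Φ : E → ℝ → E} {Z S : Set E} (hZ : MeasurableSet Z)
    (hΦ : ∀ y ∈ Z, IsForwardSolution h y (Φ y)) (hbdd : Bornology.IsBounded S)
    (hS : ∀ y ∈ Z, ∀ t, 0 ≤ t → Φ y t ∈ S) {a : ℝ → ℝ} (hlim : Tendsto a atTop atTop)
    (ha : ∀ᶠ t in atTop, ∀ y ∈ Z, a t ≤ ∫ s in (0 : ℝ)..t, divergence h (Φ y s)) :
    μ Z = 0 := by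
  have hfin : μ (Metric.cthickening 1 S) ≠ ⊤ := hbdd.cthickening.measure_lt_top.ne
  by_contra hne
  have hexp : Tendsto (fun t => ENNReal.ofReal (Real.exp (a t - 1)) * μ Z) atTop (𝓝 ⊤) := by
    have h1 : Tendsto (fun t => Real.exp (a t - 1)) atTop atTop :=
      Real.tendsto_exp_atTop.comp (tendsto_atTop_add_const_right _ _ hlim)
    have := ENNReal.Tendsto.mul_const (b := μ Z) (ENNReal.tendsto_ofReal_atTop.comp h1)
      (Or.inl ENNReal.top_ne_zero)
    rwa [ENNReal.top_mul hne] at this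
  obtain ⟨t, ht1, ht2, ht3⟩ := ((hexp.eventually_const_lt hfin.lt_top).and
    (ha.and (eventually_gt_atTop 0))).exists
  exact absurd (ofReal_exp_mul_measure_le μ hh hcs hZ hΦ ht3 (fun y hy => hS y hy t ht3.le) ht2
    one_pos) (not_le.2 ht1)

end Volume

/-! ### Grönwall's inequality with a variable coefficient -/

theorem HasDerivWithinAt.upperDiniLE {u : ℝ → ℝ} {c t : ℝ}
    (h : HasDerivWithinAt u c (Set.Ici t) t) : UpperDiniLE u c t := by
  intro r hr
  have := (hasDerivWithinAt_iff_tendsto_slope' (by simp)).1 (h.mono Set.Ioi_subset_Ici_self)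
  exact this.eventually_lt_const hr

/-- Only the inequality `log x ≤ x - 1` is needed to bound the logarithmic Dini derivative. -/
theorem UpperDiniLE.log {u : ℝ → ℝ} {b t : ℝ} (hpos : ∀ᶠ s in 𝓝[>] t, 0 < u s) (ht : 0 < u t)
    (h : UpperDiniLE u (b * u t) t) : UpperDiniLE (fun s => Real.log (u s)) b t := by
  intro r hr
  filter_upwards [hpos, h (r * u t) (mul_lt_mul_of_pos_right hr ht), self_mem_nhdsWithin]
    with s hs1 hs2 hs
  have hst : 0 < s - t := sub_pos.2 (Set.mem_Ioi.1 hs)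
  have h1 : Real.log (u s) - Real.log (u t) ≤ u s / u t - 1 := by
    rw [← Real.log_div hs1.ne' ht.ne']
    exact Real.log_le_sub_one_of_pos (div_pos hs1 ht)
  rw [inv_mul_lt_iff₀ hst] at hs2 ⊢
  refine h1.trans_lt ?_
  rw [sub_lt_iff_lt_add, div_lt_iff₀ ht]
  linarith

/-- If `D⁺u ≤ b u` with `u` positive, then `log u` grows at most by the integral of `b`. -/
theorem log_le_log_add_integral {u b : ℝ → ℝ} {a t : ℝ} (hu : ContinuousOn u (Set.Ici a))
    (hpos : ∀ s, a ≤ s → 0 < u s) (hb : ContinuousOn b (Set.Ici a))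
    (h : ∀ s, a ≤ s → UpperDiniLE u (b s * u s) s) (hat : a ≤ t) :
    Real.log (u t) ≤ Real.log (u a) + ∫ s in a..t, b s := by
  -- Extending `b` by a constant to the left of `a` makes its primitive differentiable everywhere.
  have hb' : Continuous fun s => b (max a s) :=
    hb.comp_continuous (by fun_prop) fun s => le_max_left a s
  set I : ℝ → ℝ := fun x => ∫ s in a..x, b (max a s)
  have hIt : I t = ∫ s in a..t, b s := by
    refine intervalIntegral.integral_congr fun s hs => ?_
    rw [Set.uIcc_of_le hat] at hs
    simp only [max_eq_right hs.1]
  have hder : ∀ x, HasDerivAt I (b (max a x)) x := fun x =>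
    (hb'.integral_hasStrictDerivAt a x).hasDerivAt
  have hcont : Continuous I := continuous_iff_continuousAt.2 fun x => (hder x).continuousAt
  have hD : ∀ s, a ≤ s →
      UpperDiniLE (fun x => Real.log (u x) + -I x) (0 * (Real.log (u s) + -I s) + 0) s := by
    intro s hs
    have h1 : UpperDiniLE (fun x => Real.log (u x)) (b s) s := by
      refine UpperDiniLE.log ?_ (hpos s hs) (h s hs)
      filter_upwards [self_mem_nhdsWithin] with x hx
      exact hpos x (hs.trans (Set.mem_Ioi.1 hx).le)
    have h2 := (hder s).neg.hasDerivWithinAt (s := Set.Ici s) |>.upperDiniLE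
    rw [max_eq_right hs] at h2
    refine (h1.add h2).mono ?_
    simp
  have hc : ContinuousOn (fun x => Real.log (u x) + -I x) (Set.Ici a) :=
    (hu.log fun s hs => (hpos s hs).ne').add hcont.neg.continuousOn
  have := UpperDiniLE.le_gronwallBound hc hD hat
  have hIa : I a = 0 := intervalIntegral.integral_same
  rw [gronwallBound_ε0, zero_mul, Real.exp_zero, mul_one, hIa, hIt] at this
  linarith

/-! ### Lyapunov candidates -/

namespace IsLyapunovCandidate

variable {E : Type*} [NormedAddCommGroup E] {V : E → ℝ≥0}

theorem continuous (hV : IsLyapunovCandidate V) : Continuous V := hV.locallyLipschitz.continuous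

theorem isCompact_le (hV : IsLyapunovCandidate V) (p : ℝ≥0) : IsCompact {x | V x ≤ p} := by
  obtain ⟨S, hS, hSp⟩ := mem_cocompact.1 (hV.proper (Ioi_mem_atTop p))
  refine hS.of_isClosed_subset (isClosed_le hV.continuous continuous_const) fun x hx => ?_
  by_contra hxS
  have hx' : V x ≤ p := hx
  exact absurd hx' (not_le.2 (Set.mem_Ioi.1 (hSp hxS)))

/-- Small values of a positive definite proper function are attained only near the origin. -/
theorem exists_norm_lt (hV : IsLyapunovCandidate V) {ε : ℝ} (hε : 0 < ε) :
    ∃ r > 0, ∀ x, V x < r → ‖x‖ < ε := by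
  have hc : IsCompact ({x | V x ≤ 1} ∩ {x | ε ≤ ‖x‖}) :=
    (hV.isCompact_le 1).inter_right (isClosed_le continuous_const continuous_norm)
  rcases ({x | V x ≤ 1} ∩ {x | ε ≤ ‖x‖}).eq_empty_or_nonempty with he | hne
  · refine ⟨1, one_pos, fun x hx => ?_⟩
    by_contra! hxε
    exact (Set.ext_iff.1 he x).1 ⟨hx.le, hxε⟩
  · obtain ⟨x₀, hx₀, hmin⟩ := hc.exists_isMinOn hne hV.continuous.continuousOn
    have hpos : 0 < V x₀ := hV.pos _ (norm_pos_iff.1 (hε.trans_le hx₀.2))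
    refine ⟨min 1 (V x₀), lt_min one_pos hpos, fun x hx => ?_⟩
    by_contra! hxε
    exact absurd (hmin ⟨(hx.trans_le (min_le_left _ _)).le, hxε⟩)
      (not_le.2 (hx.trans_le (min_le_right _ _)))

end IsLyapunovCandidate

/-! ### Cutting off a vector field -/

/-- A `C¹` field agrees near a given compact set with a compactly supported `C¹` field. -/
theorem exists_contDiff_hasCompactSupport_eq {E : Type*} [NormedAddCommGroup E] [NormedSpace ℝ E]
    [FiniteDimensional ℝ E] {h : E → E} (hh : ContDiff ℝ 1 h) {S : Set E} (hS : IsCompact S) :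
    ∃ k : E → E, ContDiff ℝ 1 k ∧ HasCompactSupport k ∧ ∀ y ∈ S, k =ᶠ[𝓝 y] h := by
  obtain ⟨R, hR, hSR⟩ := hS.isBounded.subset_ball_lt 0 0
  let χ : ContDiffBump (0 : E) := ⟨R, R + 1, hR, lt_add_one R⟩
  refine ⟨fun y => χ y • h y, χ.contDiff.smul hh, χ.hasCompactSupport.smul_right, fun y hy => ?_⟩
  filter_upwards [Metric.isOpen_ball.mem_nhds (hSR hy)] with z hz
  rw [χ.one_of_mem_closedBall (Metric.ball_subset_closedBall hz), one_smul]

theorem divergence_congr {E : Type*} [NormedAddCommGroup E] [NormedSpace ℝ E] {h k : E → E} {y : E}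
    (hk : k =ᶠ[𝓝 y] h) : divergence k y = divergence h y := by
  rw [divergence, divergence, hk.fderiv_eq]

/-! ### Trajectories of the interconnected system -/

/-- The interconnection of `ẋ = f(x, z)` and `ż = g(x, z)`, with Lyapunov functions `V`, `W` and
gains `γ`, `δ`; no small-gain condition is imposed. -/
structure IsInterconnection {E F : Type*} [NormedAddCommGroup E] [NormedSpace ℝ E]
    [NormedAddCommGroup F] [NormedSpace ℝ F] (f : E × F → E) (g : E × F → F) (V : E → ℝ≥0)
    (W : F → ℝ≥0) (γ δ : ℝ≥0 → ℝ≥0) : Prop where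
  contDiff_left : ContDiff ℝ 1 f
  contDiff_right : ContDiff ℝ 1 g
  candidate_left : IsLyapunovCandidate V
  candidate_right : IsLyapunovCandidate W
  gain_left : IsKInf γ
  gain_right : IsKInf δ
  dini_left : ∀ x z, diniDeriv V (f (x, z)) x ≤ ((-(V x : ℝ) + (γ (W z) : ℝ) : ℝ) : EReal)
  dini_right : ∀ x z, diniDeriv W (g (x, z)) z ≤ ((-(W z : ℝ) + (δ (V x) : ℝ) : ℝ) : EReal)

/-- The box `{V ≤ p} × {W ≤ q}`. -/
def sublevelBox {E F : Type*} (V : E → ℝ≥0) (W : F → ℝ≥0) (p q : ℝ≥0) : Set (E × F) :=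
  {x | V x ≤ p} ×ˢ {z | W z ≤ q}

theorem IsForwardSolution.shift {E : Type*} [NormedAddCommGroup E] [NormedSpace ℝ E] {h : E → E}
    {y : E} {Y : ℝ → E} (hY : IsForwardSolution h y Y) {s : ℝ} (hs : 0 ≤ s) :
    IsForwardSolution h (Y s) fun t => Y (t + s) := by
  refine ⟨by simp, fun t ht => ?_⟩
  have h1 := hY.2 (t + s) (add_nonneg ht hs)
  have h2 : HasDerivWithinAt (fun x : ℝ => x + s) 1 (Set.Ici 0) t :=
    (hasDerivWithinAt_id t _).add_const s
  have := h1.scomp t h2 fun x hx => add_nonneg (Set.mem_Ici.1 hx) hs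
  rw [one_smul] at this
  exact this

namespace IsInterconnection

variable {E F : Type*} [NormedAddCommGroup E] [NormedSpace ℝ E] [NormedAddCommGroup F]
  [NormedSpace ℝ F] {f : E × F → E} {g : E × F → F} {V : E → ℝ≥0} {W : F → ℝ≥0}
  {γ δ : ℝ≥0 → ℝ≥0} {y : E × F} {Y : ℝ → E × F} {p q : ℝ≥0}

theorem contDiff (H : IsInterconnection f g V W γ δ) : ContDiff ℝ 1 fun y => (f y, g y) :=
  H.contDiff_left.prodMk H.contDiff_right

theorem isCompact_sublevelBox (H : IsInterconnection f g V W γ δ) (p q : ℝ≥0) :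
    IsCompact (sublevelBox V W p q) :=
  (H.candidate_left.isCompact_le p).prod (H.candidate_right.isCompact_le q)

theorem upperDiniLE_left (H : IsInterconnection f g V W γ δ) {t : ℝ}
    (hY : HasDerivWithinAt Y (f (Y t), g (Y t)) (Set.Ici t) t) :
    UpperDiniLE (fun s => (V (Y s).1 : ℝ)) (-(V (Y t).1 : ℝ) + γ (W (Y t).2)) t := by
  have h : HasDerivWithinAt (fun s => (Y s).1) (f (Y t)) (Set.Ici t) t :=
    (hasFDerivAt_fst (𝕜 := ℝ) (p := Y t)).comp_hasDerivWithinAt t hY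
  exact upperDiniLE_comp_of_diniDeriv_le H.candidate_left.locallyLipschitz h
    (H.dini_left (Y t).1 (Y t).2)

theorem upperDiniLE_right (H : IsInterconnection f g V W γ δ) {t : ℝ}
    (hY : HasDerivWithinAt Y (f (Y t), g (Y t)) (Set.Ici t) t) :
    UpperDiniLE (fun s => (W (Y s).2 : ℝ)) (-(W (Y t).2 : ℝ) + δ (V (Y t).1)) t := by
  have h : HasDerivWithinAt (fun s => (Y s).2) (g (Y t)) (Set.Ici t) t :=
    (hasFDerivAt_snd (𝕜 := ℝ) (p := Y t)).comp_hasDerivWithinAt t hY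
  exact upperDiniLE_comp_of_diniDeriv_le H.candidate_right.locallyLipschitz h
    (H.dini_right (Y t).1 (Y t).2)

/-- A box with `γ q < p` and `δ p < q` is forward invariant. The curve has to follow the field only
while it is in the box, so that the statement applies to fields modified outside the box. -/
theorem mem_sublevelBox (H : IsInterconnection f g V W γ δ) (hp : γ q < p) (hq : δ p < q)
    (hYc : ContinuousOn Y (Set.Ici 0)) (hY0 : Y 0 ∈ sublevelBox V W p q)
    (hY : ∀ t, 0 ≤ t → Y t ∈ sublevelBox V W p q →
      HasDerivWithinAt Y (f (Y t), g (Y t)) (Set.Ici t) t) {t : ℝ} (ht : 0 ≤ t) :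
    Y t ∈ sublevelBox V W p q :=
  forall_le_of_upperDiniLE H.gain_left.strictMono.monotone H.gain_right.strictMono.monotone
    (v := fun s => V (Y s).1) (w := fun s => W (Y s).2)
    (H.candidate_left.continuous.comp_continuousOn hYc.fst)
    (H.candidate_right.continuous.comp_continuousOn hYc.snd) hp hq hY0.1 hY0.2
    (fun s hs h1 h2 => H.upperDiniLE_left (hY s hs ⟨h1, h2⟩))
    (fun s hs h1 h2 => H.upperDiniLE_right (hY s hs ⟨h1, h2⟩)) ht

theorem mem_sublevelBox_of_isForwardSolution (H : IsInterconnection f g V W γ δ) (hp : γ q < p)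
    (hq : δ p < q) (hy : y ∈ sublevelBox V W p q)
    (hY : IsForwardSolution (fun y => (f y, g y)) y Y) {t : ℝ} (ht : 0 ≤ t) :
    Y t ∈ sublevelBox V W p q :=
  H.mem_sublevelBox hp hq hY.continuousOn (hY.1 ▸ hy) (fun _ hs _ => hY.hasDerivWithinAt_Ici hs) ht

/-- Inside an invariant box the system may be replaced by any field with the same values there. -/
theorem isForwardSolution_iff (H : IsInterconnection f g V W γ δ) (hp : γ q < p) (hq : δ p < q)
    {k : E × F → E × F} (hk : ∀ y ∈ sublevelBox V W p q, k y = (f y, g y))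
    (hy : y ∈ sublevelBox V W p q) :
    IsForwardSolution k y Y ↔ IsForwardSolution (fun y => (f y, g y)) y Y := by
  constructor
  · intro hY
    have hmem : ∀ t, 0 ≤ t → Y t ∈ sublevelBox V W p q := fun t ht =>
      H.mem_sublevelBox hp hq hY.continuousOn (hY.1 ▸ hy)
        (fun s hs h => hk _ h ▸ hY.hasDerivWithinAt_Ici hs) ht
    refine ⟨hY.1, fun t ht => ?_⟩
    have := hY.2 t ht
    rwa [hk _ (hmem t ht)] at this
  · intro hY
    refine ⟨hY.1, fun t ht => ?_⟩
    rw [hk _ (H.mem_sublevelBox_of_isForwardSolution hp hq hy hY ht)]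
    exact hY.2 t ht

theorem exists_upper_limits (H : IsInterconnection f g V W γ δ) (hp : γ q < p) (hq : δ p < q)
    (hy : y ∈ sublevelBox V W p q) (hY : IsForwardSolution (fun y => (f y, g y)) y Y) :
    ∃ a b : ℝ≥0, a ≤ p ∧ a ≤ γ b ∧ b ≤ δ a ∧ (∀ r, a < r → ∀ᶠ t in atTop, V (Y t).1 < r) ∧
      ∀ r, b < r → ∀ᶠ t in atTop, W (Y t).2 < r :=
  _root_.exists_upper_limits H.gain_left H.gain_right
    (H.candidate_left.continuous.comp_continuousOn hY.continuousOn.fst)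
    (H.candidate_right.continuous.comp_continuousOn hY.continuousOn.snd)
    (fun _ ht => (H.mem_sublevelBox_of_isForwardSolution hp hq hy hY ht).1)
    (fun _ ht => (H.mem_sublevelBox_of_isForwardSolution hp hq hy hY ht).2)
    (fun _ ht => H.upperDiniLE_left (hY.hasDerivWithinAt_Ici ht))
    (fun _ ht => H.upperDiniLE_right (hY.hasDerivWithinAt_Ici ht))

/-- If the small-gain condition holds on `(0, p]`, then every solution starting in an invariant box
`{V ≤ p} × {W ≤ q}` tends to the origin. -/
theorem tendsto_norm_of_mem_sublevelBox (H : IsInterconnection f g V W γ δ) (hp : γ q < p)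
    (hq : δ p < q) (hsg : ∀ s, 0 < s → s ≤ p → γ (δ s) < s) (hy : y ∈ sublevelBox V W p q)
    (hY : IsForwardSolution (fun y => (f y, g y)) y Y) :
    Tendsto (fun t => ‖Y t‖) atTop (𝓝 0) := by
  obtain ⟨a, b, hap, hab, hba, ha, hb⟩ := H.exists_upper_limits hp hq hy hY
  have ha0 : a = 0 := by
    by_contra hne
    exact absurd (hab.trans (H.gain_left.strictMono.monotone hba))
      (not_le.2 (hsg a (pos_iff_ne_zero.2 hne) hap))
  have hb0 : b = 0 := by
    rw [ha0, H.gain_right.map_zero] at hba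
    exact le_zero_iff.1 hba
  subst ha0 hb0
  rw [Metric.tendsto_nhds]
  intro ε hε
  obtain ⟨r₁, hr₁, h₁⟩ := H.candidate_left.exists_norm_lt hε
  obtain ⟨r₂, hr₂, h₂⟩ := H.candidate_right.exists_norm_lt hε
  filter_upwards [ha r₁ hr₁, hb r₂ hr₂] with t ht1 ht2
  rw [dist_zero_right, norm_norm]
  exact max_lt (h₁ _ ht1) (h₂ _ ht2)

theorem exists_isForwardSolution [FiniteDimensional ℝ E] [FiniteDimensional ℝ F]
    (H : IsInterconnection f g V W γ δ) (hp : γ q < p) (hq : δ p < q)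
    (hy : y ∈ sublevelBox V W p q) : ∃ Y, IsForwardSolution (fun y => (f y, g y)) y Y := by
  obtain ⟨k, hk, hcs, hkh⟩ :=
    exists_contDiff_hasCompactSupport_eq H.contDiff (H.isCompact_sublevelBox p q)
  obtain ⟨K, hK⟩ := hk.lipschitzWith_of_hasCompactSupport hcs one_ne_zero
  obtain ⟨B, hB⟩ := hcs.exists_bound_of_continuous hk.continuous
  obtain ⟨Y, hY⟩ := _root_.exists_isForwardSolution hK hB y
  exact ⟨Y, (H.isForwardSolution_iff hp hq (fun z hz => (hkh z hz).self_of_nhds) hy).1 hY⟩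

end IsInterconnection

/-! ### Invariant boxes from the small-gain condition -/

/-- The sublevel sets of `max {σ(V), W}` are boxes. -/
theorem mem_sublevelBox_of_maxLyapunov_le {E F : Type*} {V : E → ℝ≥0} {W : F → ℝ≥0}
    {σ : ℝ≥0 → ℝ≥0} {y : E × F} (hσ : IsKInf σ) {s : ℝ≥0}
    (hy : maxLyapunov σ V W y ≤ σ s) : y ∈ sublevelBox V W s (σ s) :=
  ⟨hσ.strictMono.le_iff_le.1 ((le_max_left _ _).trans hy), (le_max_right _ _).trans hy⟩

theorem exists_nat_mem_sublevelBox {E F : Type*} {V : E → ℝ≥0} {W : F → ℝ≥0} {σg : ℝ≥0 → ℝ≥0}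
    {Mg : ℝ≥0} (hσg : IsKInf σg) (y : E × F) :
    ∃ j : ℕ, y ∈ sublevelBox V W (Mg + j) (σg (Mg + j)) := by
  obtain ⟨s, hs⟩ := hσg.surjective (W y.2)
  obtain ⟨j, hj⟩ := exists_nat_ge (max (V y.1) s)
  refine ⟨j, ((le_max_left _ _).trans hj).trans le_add_self, ?_⟩
  rw [Set.mem_ofPred_eq, ← hs]
  exact hσg.strictMono.monotone (((le_max_right _ _).trans hj).trans le_add_self)

section Boxes

variable {E F : Type*} [NormedAddCommGroup E] [NormedSpace ℝ E] [NormedAddCommGroup F]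
  [NormedSpace ℝ F] {f : E × F → E} {g : E × F → F} {V : E → ℝ≥0} {W : F → ℝ≥0}
  {γ δ σ σl σg : ℝ≥0 → ℝ≥0} {y : E × F} {Y : ℝ → E × F} {I : Set ℝ≥0} {Ml Nl Mg Ng : ℝ≥0}

theorem SmallGainOn.gain_apply_lt (hσ : SmallGainOn γ δ σ I) (hγ : IsKInf γ) {s : ℝ≥0}
    (hs : s ∈ I) : γ (σ s) < s :=
  hγ.lt_gainInv_iff.1 (hσ.upper s hs)

theorem IsInterconnection.isLyapunovStable [FiniteDimensional ℝ E] [FiniteDimensional ℝ F]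
    (H : IsInterconnection f g V W γ δ) (hMl : 0 < Ml)
    (hσl : SmallGainOn γ δ σl (Set.Ioc 0 Ml)) : IsLyapunovStable fun y => (f y, g y) := by
  intro ε hε
  obtain ⟨r₁, hr₁, h₁⟩ := H.candidate_left.exists_norm_lt hε
  obtain ⟨r₂, hr₂, h₂⟩ := H.candidate_right.exists_norm_lt hε
  -- A level `p` whose box lies in the `ε`-ball.
  have hsmall : ∀ᶠ p in 𝓝[>] (0 : ℝ≥0), p < r₁ ∧ σl p < r₂ ∧ p ∈ Set.Ioc 0 Ml := by
    have h0 : Tendsto σl (𝓝[>] 0) (𝓝 0) :=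
      (hσl.isKInf.continuous.tendsto' 0 0 hσl.isKInf.map_zero).mono_left nhdsWithin_le_nhds
    exact (eventually_nhdsWithin_of_eventually_nhds (eventually_lt_nhds hr₁)).and
      ((h0.eventually_lt_const hr₂).and (Ioc_mem_nhdsGT hMl))
  obtain ⟨p, hp1, hp2, hpI⟩ := hsmall.exists
  have hp := hσl.gain_apply_lt H.gain_left hpI
  have hq := hσl.lower p hpI
  have hnhds : sublevelBox V W p (σl p) ∈ 𝓝 (0 : E × F) := by
    refine prod_mem_nhds ?_ ?_
    · exact (H.candidate_left.continuous.tendsto' 0 0 H.candidate_left.map_zero).eventually_le_const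
        hpI.1
    · exact (H.candidate_right.continuous.tendsto' 0 0
        H.candidate_right.map_zero).eventually_le_const (hσl.isKInf.pos hpI.1)
  obtain ⟨η, hη, hball⟩ := Metric.mem_nhds_iff.1 hnhds
  refine ⟨η, hη, fun y hy => ?_⟩
  have hyb : y ∈ sublevelBox V W p (σl p) := hball (by simpa using hy)
  refine ⟨H.exists_isForwardSolution hp hq hyb, fun Y hY t ht => ?_⟩
  have hmem := H.mem_sublevelBox_of_isForwardSolution hp hq hyb hY ht
  exact max_lt (h₁ _ (hmem.1.trans_lt hp1)) (h₂ _ (hmem.2.trans_lt hp2))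

/-- The set `{U_ℓ ≤ min {δ(M_ℓ), N_ℓ}}` lies in the basin of attraction of the origin. -/
theorem IsInterconnection.tendsto_norm_of_maxLyapunov_le (H : IsInterconnection f g V W γ δ)
    (hMl : 0 < Ml) (hNl : 0 < Nl) (hσl : SmallGainOn γ δ σl (Set.Ioc 0 Ml))
    (hy : maxLyapunov σl V W y ≤ min (δ Ml) Nl)
    (hY : IsForwardSolution (fun y => (f y, g y)) y Y) :
    Tendsto (fun t => ‖Y t‖) atTop (𝓝 0) := by
  obtain ⟨p, hp⟩ := hσl.isKInf.surjective (min (δ Ml) Nl)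
  rw [← hp] at hy
  have hpM : p < Ml := by
    rw [← hσl.isKInf.strictMono.lt_iff_lt, hp]
    exact (min_le_left _ _).trans_lt (hσl.lower Ml ⟨hMl, le_rfl⟩)
  have hp0 : 0 < p := by
    rw [← hσl.isKInf.strictMono.lt_iff_lt, hp, hσl.isKInf.map_zero]
    exact lt_min (H.gain_right.pos hMl) hNl
  exact H.tendsto_norm_of_mem_sublevelBox (hσl.gain_apply_lt H.gain_left ⟨hp0, hpM.le⟩)
    (hσl.lower p ⟨hp0, hpM.le⟩) (fun s hs hsp => hσl.smallGain s ⟨hs, hsp.trans hpM.le⟩)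
    (mem_sublevelBox_of_maxLyapunov_le hσl.isKInf hy) hY

/-- The set `{U_g ≤ max {γ⁻¹(M_g), N_g}}` attracts every solution in finite time: the upper limit of
`V` is less than `M_g` by the small-gain condition on `[M_g, ∞)`. -/
theorem IsInterconnection.eventually_maxLyapunov_le (H : IsInterconnection f g V W γ δ)
    (hσg : SmallGainOn γ δ σg (Set.Ici Mg)) (hY : IsForwardSolution (fun y => (f y, g y)) y Y) :
    ∀ᶠ t in atTop, maxLyapunov σg V W (Y t) ≤ max (gainInv γ Mg) Ng := by
  obtain ⟨j, hj⟩ := exists_nat_mem_sublevelBox (V := V) (W := W) (Mg := Mg) hσg.isKInf y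
  have hI : Mg + j ∈ Set.Ici Mg := Set.mem_Ici.2 le_self_add
  obtain ⟨a, b, -, hab, hba, ha, hb⟩ := H.exists_upper_limits
    (hσg.gain_apply_lt H.gain_left hI) (hσg.lower _ hI) hj hY
  have haM : a < Mg := by
    by_contra! hle
    exact absurd (hab.trans (H.gain_left.strictMono.monotone hba)) (not_le.2 (hσg.smallGain a hle))
  have hM : Mg ∈ Set.Ici Mg := Set.self_mem_Ici
  have hbM : b < gainInv γ Mg :=
    ((hba.trans (H.gain_right.strictMono.monotone haM.le)).trans_lt (hσg.lower _ hM)).trans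
      (hσg.upper _ hM)
  filter_upwards [ha _ haM, hb _ hbM] with t ht1 ht2
  exact (max_le ((hσg.isKInf.strictMono ht1).trans (hσg.upper _ hM)).le ht2.le).trans
    (le_max_left _ _)

theorem IsInterconnection.zero_notMem_gapRegion (H : IsInterconnection f g V W γ δ)
    (hMl : 0 < Ml) (hNl : 0 < Nl) (hσl : IsKInf σl) :
    (0 : E × F) ∉ gapRegion V W γ δ σl σg Ml Nl Mg Ng := by
  have hU : Continuous (maxLyapunov σl V W) :=
    (hσl.continuous.comp (H.candidate_left.continuous.comp continuous_fst)).max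
      (H.candidate_right.continuous.comp continuous_snd)
  have hsub : gapRegion V W γ δ σl σg Ml Nl Mg Ng ⊆ {y | min (δ Ml) Nl ≤ maxLyapunov σl V W y} :=
    closure_minimal (fun y hy => by
      have hlt : min (δ Ml) Nl < maxLyapunov σl V W y := not_le.1 fun h => hy.2 h
      exact hlt.le) (isClosed_le continuous_const hU)
  intro h0
  have h1 : min (δ Ml) Nl ≤ maxLyapunov σl V W (0 : E × F) := hsub h0
  have h2 : maxLyapunov σl V W (0 : E × F) = 0 := by
    simp [maxLyapunov, H.candidate_left.map_zero, H.candidate_right.map_zero, hσl.map_zero]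
  rw [h2] at h1
  exact absurd h1 (not_le.2 (lt_min (H.gain_right.pos hMl) hNl))

end Boxes

/-! ### Null sets of trajectories trapped in a region of expansion -/

namespace IsInterconnection

variable {E F : Type*} [NormedAddCommGroup E] [NormedSpace ℝ E] [NormedAddCommGroup F]
  [NormedSpace ℝ F] {f : E × F → E} {g : E × F → F} {V : E → ℝ≥0} {W : F → ℝ≥0}
  {γ δ : ℝ≥0 → ℝ≥0} {y : E × F} {Y : ℝ → E × F} {p q : ℝ≥0}

/-- On a set where `(div h) (V + W) ≥ γ(W) + δ(V)`, the function `V + W` grows logarithmically at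
most at the rate `div h - 1`. -/
theorem log_add_le [FiniteDimensional ℝ E] [FiniteDimensional ℝ F]
    (H : IsInterconnection f g V W γ δ)
    (hY : IsForwardSolution (fun y => (f y, g y)) y Y) {T t : ℝ} (hT : 0 ≤ T) (hTt : T ≤ t)
    (hne : ∀ s, T ≤ s → Y s ≠ 0)
    (hdiv : ∀ s, T ≤ s → (γ (W (Y s).2) : ℝ) + (δ (V (Y s).1) : ℝ) ≤
      divergence (fun y => (f y, g y)) (Y s) * ((V (Y s).1 : ℝ) + (W (Y s).2 : ℝ))) :
    Real.log ((V (Y t).1 : ℝ) + W (Y t).2) ≤ Real.log ((V (Y T).1 : ℝ) + W (Y T).2) +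
      ∫ s in T..t, (divergence (fun y => (f y, g y)) (Y s) - 1) := by
  have hYc : ContinuousOn Y (Set.Ici T) := hY.continuousOn.mono (Set.Ici_subset_Ici.2 hT)
  refine log_le_log_add_integral (u := fun s => (V (Y s).1 : ℝ) + W (Y s).2) ?_ (fun s hs => ?_) ?_
    (fun s hs => ?_) hTt
  · exact (NNReal.continuous_coe.comp_continuousOn
      (H.candidate_left.continuous.comp_continuousOn hYc.fst)).add
      (NNReal.continuous_coe.comp_continuousOn
      (H.candidate_right.continuous.comp_continuousOn hYc.snd))
  · by_cases h : (Y s).1 = 0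
    · have h2 : (Y s).2 ≠ 0 := fun h2 => hne s hs (Prod.ext h h2)
      exact add_pos_of_nonneg_of_pos (NNReal.coe_nonneg _)
        (NNReal.coe_pos.2 (H.candidate_right.pos _ h2))
    · exact add_pos_of_pos_of_nonneg (NNReal.coe_pos.2 (H.candidate_left.pos _ h))
        (NNReal.coe_nonneg _)
  · exact ((continuous_divergence H.contDiff).comp_continuousOn hYc).sub continuousOn_const
  · have hd := hY.hasDerivWithinAt_Ici (hT.trans hs)
    refine ((H.upperDiniLE_left hd).add (H.upperDiniLE_right hd)).mono ?_
    linarith [hdiv s hs]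

/-- The initial values in an invariant box whose trajectories lie from time `T` on in a closed set
`R`, away from the origin, on which `(div h) (V + W) ≥ γ(W) + δ(V)`, form a null set. -/
theorem measure_setOf_trapped_eq_zero [FiniteDimensional ℝ E] [FiniteDimensional ℝ F]
    [MeasurableSpace (E × F)] [BorelSpace (E × F)] (μ : Measure (E × F)) [μ.IsAddHaarMeasure]
    (H : IsInterconnection f g V W γ δ) (hp : γ q < p) (hq : δ p < q) {R : Set (E × F)}
    (hR : IsClosed R) (hR0 : (0 : E × F) ∉ R)
    (hdiv : ∀ y ∈ R, (γ (W y.2) : ℝ) + (δ (V y.1) : ℝ) ≤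
      divergence (fun y => (f y, g y)) y * ((V y.1 : ℝ) + (W y.2 : ℝ))) {T : ℝ} (hT : 0 ≤ T) :
    μ {y | y ∈ sublevelBox V W p q ∧
      ∃ Y, IsForwardSolution (fun y => (f y, g y)) y Y ∧ ∀ t, T ≤ t → Y t ∈ R} = 0 := by
  obtain ⟨k, hk, hcs, hkh⟩ :=
    exists_contDiff_hasCompactSupport_eq H.contDiff (H.isCompact_sublevelBox p q)
  obtain ⟨K, hK⟩ := hk.lipschitzWith_of_hasCompactSupport hcs one_ne_zero
  obtain ⟨B, hB⟩ := hcs.exists_bound_of_continuous hk.continuous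
  choose Φ hΦ using _root_.exists_isForwardSolution hK hB
  have hiff : ∀ y ∈ sublevelBox V W p q, ∀ Y : ℝ → E × F,
      IsForwardSolution k y Y ↔ IsForwardSolution (fun y => (f y, g y)) y Y := fun y hy Y =>
    H.isForwardSolution_iff hp hq (fun z hz => (hkh z hz).self_of_nhds) hy
  have hmem : ∀ y ∈ sublevelBox V W p q, ∀ t, 0 ≤ t → Φ y t ∈ sublevelBox V W p q :=
    fun y hy t ht => H.mem_sublevelBox_of_isForwardSolution hp hq hy ((hiff y hy _).1 (hΦ y)) ht
  have hset : {y | y ∈ sublevelBox V W p q ∧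
      ∃ Y, IsForwardSolution (fun y => (f y, g y)) y Y ∧ ∀ t, T ≤ t → Y t ∈ R} =
      sublevelBox V W p q ∩ ⋂ t ∈ Set.Ici T, (fun y => Φ y t) ⁻¹' R := by
    ext y
    simp only [Set.mem_ofPred_eq, Set.mem_inter_iff, Set.mem_iInter, Set.mem_preimage, Set.mem_Ici]
    refine and_congr_right fun hy => ⟨?_, fun h => ⟨Φ y, (hiff y hy _).1 (hΦ y), h⟩⟩
    rintro ⟨Y, hY, hYR⟩ t ht
    rw [(hΦ y).eq hK ((hiff y hy Y).2 hY) (hT.trans ht)]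
    exact hYR t ht
  rw [hset]
  set Z := sublevelBox V W p q ∩ ⋂ t ∈ Set.Ici T, (fun y => Φ y t) ⁻¹' R with hZdef
  have hZR : ∀ y ∈ Z, ∀ t, T ≤ t → Φ y t ∈ R := fun y hy t ht => Set.mem_iInter₂.1 hy.2 t ht
  have hZ : MeasurableSet Z := by
    refine IsClosed.measurableSet ((H.isCompact_sublevelBox p q).isClosed.inter
      (isClosed_biInter fun t ht => hR.preimage ?_))
    have hlip : LipschitzWith (Real.exp (K * t)).toNNReal fun y => Φ y t :=
      LipschitzWith.of_dist_le' fun y y' => by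
        rw [mul_comm]
        exact (hΦ y).dist_le hK (hΦ y') (hT.trans ht)
    exact hlip.continuous
  -- Upper and lower bounds for `V + W` on the part of the trajectories that lies in `R`.
  obtain ⟨c, hc, hcV⟩ : ∃ c : ℝ, 0 < c ∧
      ∀ y ∈ sublevelBox V W p q ∩ R, c ≤ (V y.1 : ℝ) + W y.2 := by
    rcases (sublevelBox V W p q ∩ R).eq_empty_or_nonempty with he | hne
    · exact ⟨1, one_pos, fun y hy => absurd hy (he ▸ Set.notMem_empty y)⟩
    have hVc := H.candidate_left.continuous
    have hWc := H.candidate_right.continuous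
    have hcont : Continuous fun y : E × F => (V y.1 : ℝ) + W y.2 := by fun_prop
    obtain ⟨y₀, hy₀, hmin⟩ :=
      ((H.isCompact_sublevelBox p q).inter_right hR).exists_isMinOn hne hcont.continuousOn
    refine ⟨_, ?_, hmin⟩
    have hy0 : y₀ ≠ 0 := fun h => hR0 (h ▸ hy₀.2)
    by_cases h : y₀.1 = 0
    · have h2 : y₀.2 ≠ 0 := fun h2 => hy0 (Prod.ext h h2)
      exact add_pos_of_nonneg_of_pos (NNReal.coe_nonneg _)
        (NNReal.coe_pos.2 (H.candidate_right.pos _ h2))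
    · exact add_pos_of_pos_of_nonneg (NNReal.coe_pos.2 (H.candidate_left.pos _ h))
        (NNReal.coe_nonneg _)
  have hVC : ∀ y ∈ sublevelBox V W p q, (V y.1 : ℝ) + W y.2 ≤ p + q := fun y hy =>
    add_le_add (NNReal.coe_le_coe.2 hy.1) (NNReal.coe_le_coe.2 hy.2)
  have hdivk : Continuous (divergence k) := continuous_divergence hk
  obtain ⟨D, hD⟩ : ∃ D : ℝ, ∀ y ∈ sublevelBox V W p q, ‖divergence k y‖ ≤ D :=
    (H.isCompact_sublevelBox p q).exists_bound_of_continuousOn hdivk.continuousOn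
  refine measure_eq_zero_of_tendsto_integral_divergence μ hk hcs hZ (fun y _ => hΦ y)
    (H.isCompact_sublevelBox p q).isBounded (fun y hy t ht => hmem y hy.1 t ht)
    (a := fun t => t + (Real.log c - Real.log (p + q) - T - D * T))
    (tendsto_atTop_add_const_right _ _ tendsto_id) ?_
  filter_upwards [eventually_ge_atTop T] with t ht y hy
  have hsol := (hiff y hy.1 _).1 (hΦ y)
  have hlog := H.log_add_le hsol hT ht (fun s hs h => hR0 (h ▸ hZR y hy s hs))
    (fun s hs => hdiv _ (hZR y hy s hs))
  have hcongr : ∫ s in T..t, (divergence (fun y => (f y, g y)) (Φ y s) - 1) =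
      ∫ s in T..t, (divergence k (Φ y s) - 1) := by
    refine intervalIntegral.integral_congr fun s hs => ?_
    rw [Set.uIcc_of_le ht] at hs
    simp only [divergence_congr (hkh _ (hmem y hy.1 s (hT.trans hs.1)))]
  have hint : ∀ a b : ℝ, 0 ≤ a → a ≤ b →
      IntervalIntegrable (fun s => divergence k (Φ y s)) volume a b := fun a b ha hab =>
    ContinuousOn.intervalIntegrable_of_Icc hab
      (hdivk.comp_continuousOn ((hΦ y).continuousOn_Icc ha))
  rw [hcongr, intervalIntegral.integral_sub (hint T t hT ht) intervalIntegrable_const,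
    intervalIntegral.integral_const, smul_eq_mul, mul_one] at hlog
  have hlow := Real.log_le_log hc (hcV _ ⟨hmem y hy.1 t (hT.trans ht), hZR y hy t ht⟩)
  have hup := Real.log_le_log
    (hc.trans_le (hcV _ ⟨hmem y hy.1 T hT, hZR y hy T le_rfl⟩)) (hVC _ (hmem y hy.1 T hT))
  have hinit : ‖∫ s in (0 : ℝ)..T, divergence k (Φ y s)‖ ≤ D * |T - 0| := by
    refine intervalIntegral.norm_integral_le_of_norm_le_const fun s hs => ?_
    rw [Set.uIoc_of_le hT] at hs
    exact hD _ (hmem y hy.1 s hs.1.le)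
  rw [sub_zero, abs_of_nonneg hT] at hinit
  have hinit' := (abs_le.1 hinit).1
  rw [← intervalIntegral.integral_add_adjacent_intervals (hint 0 T le_rfl hT) (hint T t hT ht)]
  linarith

end IsInterconnection

/-- A trajectory that does not tend to the origin never enters `{U_ℓ ≤ min {δ(M_ℓ), N_ℓ}}`, but
eventually lies in `{U_g ≤ max {γ⁻¹(M_g), N_g}}`; so it is trapped in the gap region, and the
divergence condition there shows that such trajectories start in a null set. -/
theorem IsInterconnection.isAlmostGloballyAsymptoticallyStable {E F : Type*}
    [NormedAddCommGroup E] [NormedSpace ℝ E] [FiniteDimensional ℝ E]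
    [NormedAddCommGroup F] [NormedSpace ℝ F] [FiniteDimensional ℝ F]
    [MeasureSpace (E × F)] [BorelSpace (E × F)] [(volume : Measure (E × F)).IsAddHaarMeasure]
    {f : E × F → E} {g : E × F → F} {V : E → ℝ≥0} {W : F → ℝ≥0} {γ δ σl σg : ℝ≥0 → ℝ≥0}
    {Ml Nl Mg Ng : ℝ≥0} (H : IsInterconnection f g V W γ δ) (hMl : 0 < Ml) (hNl : 0 < Nl)
    (hσl : SmallGainOn γ δ σl (Set.Ioc 0 Ml)) (hσg : SmallGainOn γ δ σg (Set.Ici Mg))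
    (hdiv : ∀ x z, (x, z) ∈ gapRegion V W γ δ σl σg Ml Nl Mg Ng →
      (γ (W z) : ℝ) + (δ (V x) : ℝ) ≤
        divergence (fun y => (f y, g y)) (x, z) * ((V x : ℝ) + (W z : ℝ))) :
    IsAlmostGloballyAsymptoticallyStable fun y => (f y, g y) := by
  have hI : ∀ j : ℕ, Mg + j ∈ Set.Ici Mg := fun j => Set.mem_Ici.2 le_self_add
  have hp : ∀ j : ℕ, γ (σg (Mg + j)) < Mg + j := fun j => hσg.gain_apply_lt H.gain_left (hI j)
  have hq : ∀ j : ℕ, δ (Mg + j) < σg (Mg + j) := fun j => hσg.lower _ (hI j)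
  refine ⟨H.isLyapunovStable hMl hσl,
    ⋃ (j : ℕ) (T : ℕ), {y | y ∈ sublevelBox V W (Mg + j) (σg (Mg + j)) ∧
      ∃ Y, IsForwardSolution (fun y => (f y, g y)) y Y ∧
        ∀ t, (T : ℝ) ≤ t → Y t ∈ gapRegion V W γ δ σl σg Ml Nl Mg Ng}, ?_, fun y hy => ?_⟩
  · refine measure_iUnion_null fun j => measure_iUnion_null fun T => ?_
    exact H.measure_setOf_trapped_eq_zero volume (hp j) (hq j) isClosed_closure
      (H.zero_notMem_gapRegion hMl hNl hσl.isKInf) (fun y hy => hdiv y.1 y.2 hy) T.cast_nonneg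
  · obtain ⟨j, hj⟩ := exists_nat_mem_sublevelBox (V := V) (W := W) (Mg := Mg) hσg.isKInf y
    refine ⟨H.exists_isForwardSolution (hp j) (hq j) hj, fun Y hY => ?_⟩
    by_cases hent : ∃ t, 0 ≤ t ∧ maxLyapunov σl V W (Y t) ≤ min (δ Ml) Nl
    · obtain ⟨t, ht, hle⟩ := hent
      have := H.tendsto_norm_of_maxLyapunov_le hMl hNl hσl hle (hY.shift ht)
      exact (this.comp (tendsto_atTop_add_const_right _ (-t) tendsto_id)).congr fun s => by simp
    · push Not at hent
      obtain ⟨T, hT⟩ := eventually_atTop.1 (H.eventually_maxLyapunov_le (Ng := Ng) hσg hY)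
      obtain ⟨T', hT'⟩ := exists_nat_ge T
      refine (hy (Set.mem_iUnion₂.2
        ⟨j, T', hj, Y, hY, fun t ht => subset_closure ⟨hT t (hT'.trans ht), ?_⟩⟩)).elim
      exact fun h => not_le.2 (hent t (T'.cast_nonneg.trans ht)) h

theorem mainTheorem6 (n m : ℕ) (hn : 0 < n) (hm : 0 < m)
    (f : EuclideanSpace ℝ (Fin n) × EuclideanSpace ℝ (Fin m) → EuclideanSpace ℝ (Fin n))
    (g : EuclideanSpace ℝ (Fin n) × EuclideanSpace ℝ (Fin m) → EuclideanSpace ℝ (Fin m))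
    (hf : ContDiff ℝ 1 f) (hg : ContDiff ℝ 1 g)
    (V : EuclideanSpace ℝ (Fin n) → ℝ≥0) (W : EuclideanSpace ℝ (Fin m) → ℝ≥0)
    (hV : IsLyapunovCandidate V) (hW : IsLyapunovCandidate W)
    (γ δ : ℝ≥0 → ℝ≥0) (hγ : IsKInf γ) (hδ : IsKInf δ)
    (hDV : ∀ x z, diniDeriv V (f (x, z)) x ≤ ((-(V x : ℝ) + (γ (W z) : ℝ) : ℝ) : EReal))
    (hDW : ∀ x z, diniDeriv W (g (x, z)) z ≤ ((-(W z : ℝ) + (δ (V x) : ℝ) : ℝ) : EReal))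
    (hzero : ∃ L : ℝ≥0, L < 1 ∧ Tendsto (fun s : ℝ≥0 => γ (δ s) / s) (𝓝[>] 0) (𝓝 L))
    (hinfty : ∃ L : ℝ≥0, L < 1 ∧ Tendsto (fun s : ℝ≥0 => γ (δ s) / s) atTop (𝓝 L)) :
    (∃ (σl σg : ℝ≥0 → ℝ≥0) (Ml Nl Mg Ng : ℝ≥0), 0 < Ml ∧ 0 < Nl ∧ Ml < Mg ∧
      SmallGainOn γ δ σl (Set.Ioc 0 Ml) ∧ SmallGainOn γ δ σg (Set.Ici Mg)) ∧
    ∀ (σl σg : ℝ≥0 → ℝ≥0) (Ml Nl Mg Ng : ℝ≥0), 0 < Ml → 0 < Nl → 0 < Mg →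
      SmallGainOn γ δ σl (Set.Ioc 0 Ml) → SmallGainOn γ δ σg (Set.Ici Mg) →
      (∀ x z, (x, z) ∈ gapRegion V W γ δ σl σg Ml Nl Mg Ng →
        (γ (W z) : ℝ) + (δ (V x) : ℝ) ≤
          divergence (fun y => (f y, g y)) (x, z) * ((V x : ℝ) + (W z : ℝ))) →
      IsAlmostGloballyAsymptoticallyStable (fun y => (f y, g y)) := by
  refine ⟨exists_smallGainOn hγ hδ hzero hinfty,
    fun σl σg Ml Nl Mg Ng hMl hNl _ hσl hσg hdiv => ?_⟩
  have H : IsInterconnection f g V W γ δ := ⟨hf, hg, hV, hW, hγ, hδ, hDV, hDW⟩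
  -- Instance search finds the Haar property only for the unfolded product measure.
  have : (volume : Measure
      (EuclideanSpace ℝ (Fin n) × EuclideanSpace ℝ (Fin m))).IsAddHaarMeasure :=
    inferInstanceAs (Measure.prod volume volume).IsAddHaarMeasure
  exact H.isAlmostGloballyAsymptoticallyStable hMl hNl hσl hσg hdiv
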